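/- **Model.** For even $n$ let $\sigma:[n]\to\{1,2\}$ be a labelling with two clusters of equal size $n/2$. In the geometric block model $\mathrm{GBM}(n,\sigma,\theta_1,\theta_2)$ the nodes have i.i.d. features $X_u\sim\mathrm{Unif}[0,1]$, and with $d_{uv}=\min(|X_u-X_v|,1-|X_u-X_v|)$ two distinct nodes $u,v$ are adjacent iff $d_{uv}\le\theta_1\frac{\log n}{n}$ when $\sigma(u)=\sigma(v)$, respectively $d_{uv}\le\theta_2\frac{\log n}{n}$ when $\sigma(u)\ne\sigma(v)$. **Algorithm 2 with parameter $t$.** Phase 1: for every edge $(u,v)$ of the observed graph $G$ let $T^{uv}$ be the number of triangles of $G$ that cover it; the graph $G_r$ is obtained from $G$ by removing every edge with $T^{uv}\le(2\theta_2+t)\log n$. Phase 2: query the label of one (arbitrary) node in each connected component of $G_r$ and give every node the label of the queried node of its component. **Constants.** For $c\in\mathbb R$ put $$t_1[c]=\inf\Big\{t\ge0:(2\theta_2+t)\log\tfrac{2\theta_2+t}{2\theta_2}-t>c\Big\},$$ $t_1=t_1[1]$ and $t_1^{(n)}=t_1\big[1+\tfrac{2\log\log n}{\log n}\big]$, and $$\eta=\inf\Big\{0\le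 t<\theta_1+\theta_2-2:(\theta_1+\theta_2-2-t)\log\tfrac{\theta_1+\theta_2-2-t}{\theta_1+\theta_2-2}+t>1\Big\},$$ $$R=\sup\Big\{0<r<\min(\theta_1-\theta_2-t_1,2):(2\theta_2+t_1)\log\tfrac{2\theta_2+t_1}{\theta_1+\theta_2-r}+\theta_1+\theta_2-r-(2\theta_2+t_1)>1\Big\},$$ where the infimum or supremum of the empty set is read as $0$. **Theorem.** Let $\theta_1,\theta_2$ be constants with $\theta_1\ge2\theta_2$, $\theta_2\ge1$ and $2\theta_2+t_1>\theta_1+\theta_2-2-\eta$. Then $t_1^{(n)}\to t_1$, and there is a sequence $\delta_n\to0$ such that for all $n$ and all labellings $\sigma$ of $[n]$ with two clusters of equal size the following holds with probability at least $1-\delta_n$: whichever nodes are chosen in Phase 2, Algorithm 2 with parameter $t_1^{(n)}$, run on $\mathrm{GBM}(n,\sigma,\theta_1,\theta_2)$, recovers the clusters exactly (the assigned labels equal $\sigma$) and makes at most $$\tfrac32\,n^{1-R/2}+2$$ label queries. -/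

import Mathlib

open MeasureTheory Filter Topology

noncomputable section

/-- Distance of two features on the circle of length one. -/
def torusDist (x y : ℝ) : ℝ := min |x - y| (1 - |x - y|)

lemma torusDist_comm (x y : ℝ) : torusDist x y = torusDist y x := by
  unfold torusDist
  rw [abs_sub_comm]

/-- The geometric block model graph on `n` nodes with labels `σ` and feature vector `X`. -/
def gbmGraph {n : ℕ} (σ : Fin n → Fin 2) (θ₁ θ₂ : ℝ) (X : Fin n → ℝ) :
    SimpleGraph (Fin n) where
  Adj u v := u ≠ v ∧
    torusDist (X u) (X v) ≤ (if σ u = σ v then θ₁ else θ₂) * (Real.log n / n)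
  symm := by
    refine ⟨fun u v h => ?_⟩
    refine ⟨h.1.symm, ?_⟩
    rw [torusDist_comm]
    simpa only [eq_comm] using h.2
  loopless := ⟨fun _ h => h.1 rfl⟩

/-- The law of the features: independent, uniform on `[0, 1]`. -/
def featureLaw (n : ℕ) : Measure (Fin n → ℝ) :=
  Measure.pi fun _ => volume.restrict (Set.Icc (0 : ℝ) 1)

/-- The two clusters have equal size. -/
def IsBalanced {n : ℕ} (σ : Fin n → Fin 2) : Prop :=
  {u | σ u = 0}.ncard = {u | σ u = 1}.ncard

/-- The number of triangles of `G` that cover the pair `(u, v)`. -/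
def triangleCount {n : ℕ} (G : SimpleGraph (Fin n)) (u v : Fin n) : ℕ :=
  (G.commonNeighbors u v).ncard

lemma triangleCount_comm {n : ℕ} (G : SimpleGraph (Fin n)) (u v : Fin n) :
    triangleCount G u v = triangleCount G v u := by
  unfold triangleCount
  rw [SimpleGraph.commonNeighbors_symm]

/-- Phase 1: remove every edge whose triangle count (in `G`) is at most `thr`. -/
def phaseOne {n : ℕ} (G : SimpleGraph (Fin n)) (thr : ℝ) : SimpleGraph (Fin n) where
  Adj u v := G.Adj u v ∧ thr < triangleCount G u v
  symm := by
    refine ⟨fun u v h => ?_⟩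
    refine ⟨h.1.symm, ?_⟩
    rw [triangleCount_comm]
    exact h.2
  loopless := ⟨fun _ h => h.1.ne rfl⟩

/-- A rule that picks one node in each connected component of each graph. -/
abbrev RepresentativeRule (n : ℕ) : Type :=
  (H : SimpleGraph (Fin n)) → (C : H.ConnectedComponent) → C.supp

/-- The outcome of a run: the estimated labels and the set of nodes whose label was queried. -/
structure ActiveRun (n : ℕ) where
  labels : Fin n → Fin 2
  queried : Set (Fin n)

/-- Aggressive edge removal. Phase 1 removes from `G` the edges with triangle count at most
`(2 θ₂ + t) log n`; Phase 2 queries the oracle at one node of each connected component of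
the remaining graph and gives the answer as label to the whole component. -/
def aggressiveRemoval {n : ℕ} (θ₂ t : ℝ) (pick : RepresentativeRule n)
    (oracle : Fin n → Fin 2) (G : SimpleGraph (Fin n)) : ActiveRun n :=
  let H := phaseOne G ((2 * θ₂ + t) * Real.log n)
  { labels := fun v => oracle (pick H (H.connectedComponentMk v))
    queried := Set.range fun C : H.ConnectedComponent => (pick H C : Fin n) }

/-- The infimum of the `t ≥ 0` at which the upper-tail exponent of the cross-cluster triangle
count exceeds the level `c`. -/
def tailParam (θ₂ c : ℝ) : ℝ :=
  sInf {t : ℝ | 0 ≤ t ∧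
    c < (2 * θ₂ + t) * Real.log ((2 * θ₂ + t) / (2 * θ₂)) - t}

/-- `t₁`: exponent level `1`. -/
def tOne (θ₂ : ℝ) : ℝ := tailParam θ₂ 1

/-- `t₁` with its lower order correction at `n` nodes: exponent level
`1 + 2 log log n / log n`, that is, tail probability `1 / (n (log n)²)`. -/
def tOneAt (θ₂ : ℝ) (n : ℕ) : ℝ :=
  tailParam θ₂ (1 + 2 * Real.log (Real.log n) / Real.log n)

/-- `η`. -/
def etaParam (θ₁ θ₂ : ℝ) : ℝ :=
  sInf {t : ℝ | 0 ≤ t ∧ t < θ₁ + θ₂ - 2 ∧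
    1 < (θ₁ + θ₂ - 2 - t) * Real.log ((θ₁ + θ₂ - 2 - t) / (θ₁ + θ₂ - 2)) + t}

/-- `R`; it is `0` if no `r` qualifies. -/
def survivalRadius (θ₁ θ₂ : ℝ) : ℝ :=
  sSup {r : ℝ | 0 < r ∧ r < min (θ₁ - θ₂ - tOne θ₂) 2 ∧
    1 < (2 * θ₂ + tOne θ₂) * Real.log ((2 * θ₂ + tOne θ₂) / (θ₁ + θ₂ - r))
      + (θ₁ + θ₂ - r - (2 * θ₂ + tOne θ₂))}

end

/-! Every tail estimate is a Chernoff bound in Poisson form: a count of mean `m log n` passes the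
level `a log n` with probability about `n ^ (-I)`, where `I = poissonRate m a`. Given the features
of a pair the other features are independent, so exponential moments of triangle counts factor
(`lintegral_mul_prod_le`).

Exact recovery: a common neighbour of `u`, `v` in different clusters shares its label with exactly
one of them, hence lies within `θ₂ log n / n` of the other. The triangle count of a cross edge is
thus dominated by one of mean at most `2 θ₂ log n`. The level in `tOneAt` makes the upper tail at
most `1 / (n log² n)`; over `n²` pairs, each close with probability at most `2 θ₂ log n / n`, the
expected number of surviving cross edges is `O(1 / log n)`. Without such edges every component is
monochromatic.

Query count: charge each component to its rightmost node. That node lies within `ρ log n / n` of the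
right end, or its cluster has a gap of that length to its right, or its edge to a node of its
cluster at most that far away was removed. By balance such a pair has mean triangle count about `(θ₁
+ θ₂ - ρ) log n` or more, so the expected numbers are `O(log n)`, `O(n ^ (1 - ρ/2))` and `O(n ^ (1 -
I) log n)`, with `I` the lower-tail rate. `survivalRadius_cases` gives `R < 2` and some `ρ > R` with
`I > R/2`, so all three are `o(n ^ (1 - R/2))` and Markov's inequality concludes. The condition on
`η` excludes `R = 2`; if `R = 0`, the trivial bound `n` is enough. -/

/-! ### The Poisson rate function. -/

/-- The large deviation rate at `a` of a Poisson variable of mean `m`. -/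
noncomputable def poissonRate (m a : ℝ) : ℝ := a * Real.log (a / m) + m - a

lemma poissonRate_self {m : ℝ} (hm : 0 < m) : poissonRate m m = 0 := by
  simp [poissonRate, hm.ne']

/-- `klFun` is continuous everywhere, which covers the endpoint `a = 0` of the logarithmic formula.
-/
lemma poissonRate_eq_klFun {m : ℝ} (hm : 0 < m) (a : ℝ) :
    poissonRate m a = m * InformationTheory.klFun (a / m) := by
  unfold poissonRate InformationTheory.klFun
  field_simp

lemma continuous_poissonRate {m : ℝ} (hm : 0 < m) : Continuous (poissonRate m) := by
  have h : poissonRate m = fun a => m * InformationTheory.klFun (a / m) :=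
    funext (poissonRate_eq_klFun hm)
  rw [h]
  exact continuous_const.mul
    (InformationTheory.continuous_klFun.comp (continuous_id.div_const m))

lemma hasDerivAt_poissonRate {m a : ℝ} (hm : 0 < m) (ha : 0 < a) :
    HasDerivAt (poissonRate m) (Real.log (a / m)) a := by
  have h : poissonRate m = fun a => m * InformationTheory.klFun (a / m) :=
    funext (poissonRate_eq_klFun hm)
  rw [h]
  have h1 := ((InformationTheory.hasDerivAt_klFun (div_pos ha hm).ne').comp a
    ((hasDerivAt_id a).div_const m)).const_mul m
  refine h1.congr_deriv ?_
  field_simp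

lemma strictMonoOn_poissonRate {m : ℝ} (hm : 0 < m) :
    StrictMonoOn (poissonRate m) (Set.Ici m) := by
  refine strictMonoOn_of_deriv_pos (convex_Ici m) (continuous_poissonRate hm).continuousOn ?_
  intro x hx
  rw [interior_Ici, Set.mem_Ioi] at hx
  rw [(hasDerivAt_poissonRate hm (hm.trans hx)).deriv]
  exact Real.log_pos ((one_lt_div hm).2 hx)

lemma strictAntiOn_poissonRate {m : ℝ} (hm : 0 < m) :
    StrictAntiOn (poissonRate m) (Set.Icc 0 m) := by
  refine strictAntiOn_of_deriv_neg (convex_Icc 0 m) (continuous_poissonRate hm).continuousOn ?_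
  intro x hx
  rw [interior_Icc, Set.mem_Ioo] at hx
  rw [(hasDerivAt_poissonRate hm hx.1).deriv]
  exact Real.log_neg (div_pos hx.1 hm) ((div_lt_one hm).2 hx.2)

/-! ### The threshold `t₁` and its finite-size version. -/

lemma tailParam_eq (θ₂ c : ℝ) :
    tailParam θ₂ c = sInf {t : ℝ | 0 ≤ t ∧ c < poissonRate (2 * θ₂) (2 * θ₂ + t)} := by
  unfold tailParam poissonRate
  congr 1
  ext t
  simp only [Set.mem_ofPred_eq]
  ring_nf

lemma exists_lt_poissonRate {θ₂ : ℝ} (hθ₂ : 0 < θ₂) (c : ℝ) :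
    ∃ t : ℝ, 0 ≤ t ∧ c < poissonRate (2 * θ₂) (2 * θ₂ + t) := by
  -- The first summand makes the logarithm at least `2`, so the rate is at least `4 θ₂ + t`; the
  -- rest makes `t` exceed `c`.
  refine ⟨2 * θ₂ * Real.exp 2 + |c| + 1, by positivity, ?_⟩
  set t := 2 * θ₂ * Real.exp 2 + |c| + 1 with ht
  have ht0 : 0 < t := by positivity
  have hc := le_abs_self c
  have hlog : 2 ≤ Real.log ((2 * θ₂ + t) / (2 * θ₂)) := by
    rw [Real.le_log_iff_exp_le (by positivity), le_div_iff₀ (by positivity)]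
    have := abs_nonneg c
    nlinarith
  have hexp : (0 : ℝ) < 2 * θ₂ * Real.exp 2 := by positivity
  unfold poissonRate
  nlinarith [mul_le_mul_of_nonneg_left hlog (by positivity : 0 ≤ 2 * θ₂ + t)]

lemma tailParam_nonneg (θ₂ c : ℝ) : 0 ≤ tailParam θ₂ c :=
  Real.sInf_nonneg fun _ h => h.1

lemma tailParam_le {θ₂ c t : ℝ} (ht : 0 ≤ t)
    (h : c < poissonRate (2 * θ₂) (2 * θ₂ + t)) : tailParam θ₂ c ≤ t := by
  rw [tailParam_eq]
  exact csInf_le ⟨0, fun _ h => h.1⟩ ⟨ht, h⟩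

/-- The infimum lies in the closure of its defining set, where the strict inequality survives as a
weak one. This is all the tail bound needs. -/
lemma le_poissonRate_tailParam {θ₂ : ℝ} (hθ₂ : 0 < θ₂) (c : ℝ) :
    c ≤ poissonRate (2 * θ₂) (2 * θ₂ + tailParam θ₂ c) := by
  have hmem := csInf_mem_closure (s := {t : ℝ | 0 ≤ t ∧ c < poissonRate (2 * θ₂) (2 * θ₂ + t)})
    (exists_lt_poissonRate hθ₂ c) ⟨0, fun _ h => h.1⟩
  rw [← tailParam_eq] at hmem
  have hcont : Continuous fun t => poissonRate (2 * θ₂) (2 * θ₂ + t) :=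
    (continuous_poissonRate (by positivity)).comp (continuous_const.add continuous_id)
  exact closure_minimal (fun t ht => ht.2.le) (isClosed_le continuous_const hcont) hmem

/-- `tailParam` is the generalised inverse of the rate to the right of its mean; strict monotonicity
there rules out jumps. -/
lemma continuousAt_tailParam {θ₂ c : ℝ} (hθ₂ : 0 < θ₂) : ContinuousAt (tailParam θ₂) c := by
  have hm : 0 < 2 * θ₂ := by positivity
  have hmono := strictMonoOn_poissonRate hm
  have h0 := tailParam_nonneg θ₂ c
  have hlt : ∀ s t : ℝ, 0 ≤ s → s < t →
      poissonRate (2 * θ₂) (2 * θ₂ + s) < poissonRate (2 * θ₂) (2 * θ₂ + t) := fun s t hs hst =>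
    hmono (by simp [hs]) (by simp only [Set.mem_Ici]; linarith) (by linarith)
  refine tendsto_order.2 ⟨fun a ha => ?_, fun b hb => ?_⟩
  · rcases lt_or_ge a 0 with ha0 | ha0
    · exact Eventually.of_forall fun x => ha0.trans_le (tailParam_nonneg θ₂ x)
    · obtain ⟨s, has, hs⟩ := exists_between ha
      obtain ⟨s', hss', hs'⟩ := exists_between hs
      have hs'c : poissonRate (2 * θ₂) (2 * θ₂ + s') ≤ c := by
        by_contra! h
        exact absurd (tailParam_le (by linarith) h) (not_le.2 hs')
      filter_upwards [lt_mem_nhds ((hlt s s' (by linarith) hss').trans_le hs'c)] with x hx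
      refine has.trans_le ?_
      by_contra! h
      have h1 := le_poissonRate_tailParam hθ₂ x
      have h2 := hlt _ _ (tailParam_nonneg θ₂ x) h
      linarith
  · obtain ⟨s, hs, hsb⟩ := exists_between hb
    have h1 := (le_poissonRate_tailParam hθ₂ c).trans_lt (hlt _ _ h0 hs)
    filter_upwards [gt_mem_nhds h1] with x hx
    exact (tailParam_le (by linarith) hx).trans_lt hsb

lemma tendsto_log_log_div_log :
    Tendsto (fun n : ℕ => Real.log (Real.log n) / Real.log n) atTop (𝓝 0) := by
  have h : Tendsto (fun x : ℝ => Real.log x / x) atTop (𝓝 0) := by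
    simpa using Real.isLittleO_log_id_atTop.tendsto_div_nhds_zero
  exact h.comp (Real.tendsto_log_atTop.comp tendsto_natCast_atTop_atTop)

lemma tendsto_tOneAt {θ₂ : ℝ} (hθ₂ : 0 < θ₂) : Tendsto (tOneAt θ₂) atTop (𝓝 (tOne θ₂)) := by
  have h : Tendsto (fun n : ℕ => 1 + 2 * Real.log (Real.log n) / Real.log n) atTop (𝓝 1) := by
    simpa [mul_div_assoc] using (tendsto_log_log_div_log.const_mul 2).const_add 1
  exact (continuousAt_tailParam (c := 1) hθ₂).tendsto.comp h

/-! ### The survival radius `R`. -/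

lemma survivalRadius_eq (θ₁ θ₂ : ℝ) : survivalRadius θ₁ θ₂ =
    sSup {r : ℝ | 0 < r ∧ r < min (θ₁ - θ₂ - tOne θ₂) 2 ∧
      1 < poissonRate (θ₁ + θ₂ - r) (2 * θ₂ + tOne θ₂)} := by
  unfold survivalRadius poissonRate
  congr 1
  ext r
  simp only [Set.mem_ofPred_eq]
  ring_nf

lemma continuousAt_poissonRate₂ {m a : ℝ} (hm : 0 < m) (ha : 0 < a) :
    ContinuousAt (fun p : ℝ × ℝ => poissonRate p.1 p.2) (m, a) := by
  unfold poissonRate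
  have h : ContinuousAt (fun p : ℝ × ℝ => Real.log (p.2 / p.1)) (m, a) :=
    (continuousAt_snd.div continuousAt_fst hm.ne').log (div_pos ha hm).ne'
  exact ((continuousAt_snd.mul h).add continuousAt_fst).sub continuousAt_snd

/-- Below the mean the rate strictly decreases, so a rate of at least `1` at the threshold would
exceed `1` slightly to its left, at a point still above `θ₁ + θ₂ - 2 - η`. This contradicts the
infimum defining `η`. -/
lemma eta_obstruction {θ₁ θ₂ : ℝ} (hτ : 0 < 2 * θ₂ + tOne θ₂)
    (hlt : 2 * θ₂ + tOne θ₂ < θ₁ + θ₂ - 2)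
    (hη : θ₁ + θ₂ - 2 - etaParam θ₁ θ₂ < 2 * θ₂ + tOne θ₂) :
    poissonRate (θ₁ + θ₂ - 2) (2 * θ₂ + tOne θ₂) < 1 := by
  by_contra! hge
  set τ := 2 * θ₂ + tOne θ₂ with hτdef
  set m := θ₁ + θ₂ - 2 with hm
  obtain ⟨a, ha, haτ⟩ := exists_between (max_lt hτ hη)
  rw [max_lt_iff] at ha
  have h1 : 1 < poissonRate m a :=
    hge.trans_lt (strictAntiOn_poissonRate (hτ.trans hlt) ⟨ha.1.le, (haτ.trans hlt).le⟩
      ⟨hτ.le, hlt.le⟩ haτ)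
  have h2 : etaParam θ₁ θ₂ ≤ m - a := by
    unfold etaParam
    refine csInf_le ⟨0, fun _ h => h.1⟩ ⟨by linarith, by linarith, ?_⟩
    rw [← hm, sub_sub_cancel]
    unfold poissonRate at h1
    linarith
  linarith

/-- Either no radius survives, or the radius and the threshold can be enlarged a little without
the removal probability becoming too large. -/
lemma survivalRadius_cases {θ₁ θ₂ : ℝ} (hθ₂ : 1 ≤ θ₂)
    (hη : θ₁ + θ₂ - 2 - etaParam θ₁ θ₂ < 2 * θ₂ + tOne θ₂) :
    survivalRadius θ₁ θ₂ = 0 ∨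
      (0 < survivalRadius θ₁ θ₂ ∧ survivalRadius θ₁ θ₂ < 2 ∧
        ∃ ρ τ : ℝ, survivalRadius θ₁ θ₂ < ρ ∧ ρ < 2 ∧ 2 * θ₂ + tOne θ₂ < τ ∧
          τ < θ₁ + θ₂ - ρ ∧ survivalRadius θ₁ θ₂ / 2 < poissonRate (θ₁ + θ₂ - ρ) τ) := by
  have ht := tailParam_nonneg θ₂ 1
  change 0 ≤ tOne θ₂ at ht
  set S := {r : ℝ | 0 < r ∧ r < min (θ₁ - θ₂ - tOne θ₂) 2 ∧
      1 < poissonRate (θ₁ + θ₂ - r) (2 * θ₂ + tOne θ₂)} with hS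
  have hR : survivalRadius θ₁ θ₂ = sSup S := survivalRadius_eq θ₁ θ₂
  rcases S.eq_empty_or_nonempty with hempty | hne
  · left
    rw [hR, hempty, Real.sSup_empty]
  right
  set R := survivalRadius θ₁ θ₂ with hRdef
  set τ₀ := 2 * θ₂ + tOne θ₂ with hτ₀
  have hτ₀pos : 0 < τ₀ := by linarith
  have hbdd : BddAbove S := ⟨2, fun r hr => (hr.2.1.trans_le (min_le_right _ _)).le⟩
  have hRpos : 0 < R := by
    obtain ⟨r, hr⟩ := hne
    exact hr.1.trans_le (hR ▸ le_csSup hbdd hr)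
  have hRle : R ≤ min (θ₁ - θ₂ - tOne θ₂) 2 := hR ▸ csSup_le hne fun r hr => hr.2.1.le
  have hmR : 0 < θ₁ + θ₂ - R := by
    have := hRle.trans (min_le_left _ _)
    linarith
  have hrate : 1 ≤ poissonRate (θ₁ + θ₂ - R) τ₀ := by
    have hcl : R ∈ closure S := hR ▸ csSup_mem_closure hne hbdd
    have hca : ContinuousAt (fun r => poissonRate (θ₁ + θ₂ - r) τ₀) R :=
      ContinuousAt.comp' (f := fun r => (θ₁ + θ₂ - r, τ₀))
        (continuousAt_poissonRate₂ hmR hτ₀pos) (by fun_prop)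
    rw [mem_closure_iff_nhdsWithin_neBot] at hcl
    exact ge_of_tendsto (hca.tendsto.mono_left (nhdsWithin_le_nhds (s := S)))
      (eventually_mem_nhdsWithin.mono fun r hr => hr.2.2.le)
  have hτR : τ₀ < θ₁ + θ₂ - R := by
    -- At equality the rate would be `0`, but by continuity it is at least `1`.
    refine lt_of_le_of_ne (by linarith [hRle.trans (min_le_left _ _)]) fun h => ?_
    rw [← h, poissonRate_self hτ₀pos] at hrate
    linarith
  have hR2 : R < 2 := by
    refine lt_of_le_of_ne (hRle.trans (min_le_right _ _)) fun h => ?_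
    rw [h] at hτR hrate
    exact absurd (eta_obstruction hτ₀pos hτR hη) (not_lt.2 hrate)
  refine ⟨hRpos, hR2, ?_⟩
  -- At `e = 0` the rate is at least `1 > R / 2`, so radius and threshold can both grow by a small
  -- `e`. The gain in the threshold later absorbs the fluctuation of `tOneAt`.
  have hc : ContinuousAt (fun e : ℝ => poissonRate (θ₁ + θ₂ - (R + e)) (τ₀ + e)) 0 :=
    ContinuousAt.comp' (f := fun e : ℝ => (θ₁ + θ₂ - (R + e), τ₀ + e))
      (g := fun p : ℝ × ℝ => poissonRate p.1 p.2)
      (by simpa using continuousAt_poissonRate₂ hmR hτ₀pos) (by fun_prop)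
  have h1 : ∀ᶠ e in 𝓝 (0 : ℝ), R / 2 < poissonRate (θ₁ + θ₂ - (R + e)) (τ₀ + e) :=
    hc.eventually_const_lt (by simp only [add_zero]; linarith)
  have h2 : ∀ᶠ e in 𝓝 (0 : ℝ), e < 2 - R := gt_mem_nhds (by linarith)
  have h3 : ∀ᶠ e in 𝓝 (0 : ℝ), e < (θ₁ + θ₂ - R - τ₀) / 2 := gt_mem_nhds (by linarith)
  obtain ⟨e, he, he1, he2, he3⟩ := ((eventually_mem_nhdsWithin (s := Set.Ioi (0 : ℝ))).and
    (nhdsWithin_le_nhds (h1.and (h2.and h3)))).exists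
  have he' : 0 < e := he
  exact ⟨R + e, τ₀ + e, by linarith, by linarith, by linarith, by linarith, he1⟩

/-! ### Integrating out independent coordinates. -/

/-- Coordinates in `s` of a product law are integrated out one at a time. -/
lemma lintegral_mul_prod_le {ι : Type*} [Fintype ι] [DecidableEq ι] {μ : ι → Measure ℝ}
    [∀ i, IsProbabilityMeasure (μ i)] (s : Finset ι) (g : (ι → ℝ) → ENNReal)
    (φ : ι → (ι → ℝ) → ℝ → ENNReal) (c : ι → ENNReal) (hg : Measurable g)
    (hφ : ∀ i ∈ s, Measurable fun X : ι → ℝ => φ i X (X i))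
    (hg_dep : ∀ i ∈ s, ∀ X z, g (Function.update X i z) = g X)
    (hφ_dep : ∀ i ∈ s, ∀ j ∈ s, ∀ X z, φ j (Function.update X i z) = φ j X)
    (hc : ∀ i ∈ s, ∀ X, g X ≠ 0 → ∫⁻ z, φ i X z ∂μ i ≤ c i) :
    ∫⁻ X, g X * ∏ i ∈ s, φ i X (X i) ∂Measure.pi μ
      ≤ (∏ i ∈ s, c i) * ∫⁻ X, g X ∂Measure.pi μ := by
  induction s using Finset.induction_on generalizing g with
  | empty => simp
  | insert a s ha ih =>
    have hmeas : Measurable fun X => g X * φ a X (X a) :=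
      hg.mul (hφ a (Finset.mem_insert_self a s))
    -- With the other coordinates frozen, `X a` enters only through `φ a`. The bound `c a` is needed
    -- only where `g` does not vanish, which later supplies the closeness of the pair.
    have hstep : ∫⁻ X, g X * φ a X (X a) ∂Measure.pi μ
        ≤ ∫⁻ X, c a * g X ∂Measure.pi μ := by
      refine lintegral_le_of_lmarginal_le {a} hmeas (hg.const_mul _) fun X => ?_
      have hz : Measurable (φ a X) := by
        have h := (hφ a (Finset.mem_insert_self a s)).comp (measurable_update X (a := a))
        simpa only [Function.comp_def, Function.update_self,
          hφ_dep a (Finset.mem_insert_self a s) a (Finset.mem_insert_self a s)] using h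
      simp only [lmarginal_singleton, Function.update_self,
        hg_dep a (Finset.mem_insert_self a s),
        hφ_dep a (Finset.mem_insert_self a s) a (Finset.mem_insert_self a s)]
      rw [lintegral_const_mul _ hz, lintegral_const, measure_univ, mul_one, mul_comm]
      rcases eq_or_ne (g X) 0 with h | h
      · simp [h]
      · gcongr
        exact hc a (Finset.mem_insert_self a s) X h
    simp only [Finset.prod_insert ha]
    calc ∫⁻ X, g X * (φ a X (X a) * ∏ i ∈ s, φ i X (X i)) ∂Measure.pi μ
        = ∫⁻ X, (g X * φ a X (X a)) * ∏ i ∈ s, φ i X (X i) ∂Measure.pi μ := by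
          simp only [mul_assoc]
      _ ≤ (∏ i ∈ s, c i) * ∫⁻ X, g X * φ a X (X a) ∂Measure.pi μ := by
          refine ih _ hmeas (fun i hi => hφ i (Finset.mem_insert_of_mem hi)) ?_ ?_ ?_
          · intro i hi X z
            have hia : a ≠ i := fun h => ha (h ▸ hi)
            rw [hg_dep i (Finset.mem_insert_of_mem hi),
              hφ_dep i (Finset.mem_insert_of_mem hi) a (Finset.mem_insert_self a s),
              Function.update_of_ne hia]
          · exact fun i hi j hj =>
              hφ_dep i (Finset.mem_insert_of_mem hi) j (Finset.mem_insert_of_mem hj)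
          · exact fun i hi X hX =>
              hc i (Finset.mem_insert_of_mem hi) X (left_ne_zero_of_mul hX)
      _ ≤ (∏ i ∈ s, c i) * ∫⁻ X, c a * g X ∂Measure.pi μ := by gcongr
      _ = c a * (∏ i ∈ s, c i) * ∫⁻ X, g X ∂Measure.pi μ := by
          rw [lintegral_const_mul _ hg]; ring

/-! ### Arc lengths on the circle. -/

lemma measurable_torusDist : Measurable fun p : ℝ × ℝ => torusDist p.1 p.2 := by
  unfold torusDist
  fun_prop

lemma Measurable.torusDist {α : Type*} [MeasurableSpace α] {f g : α → ℝ} (hf : Measurable f)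
    (hg : Measurable g) : Measurable fun x => torusDist (f x) (g x) :=
  measurable_torusDist.comp (hf.prodMk hg)

instance : IsProbabilityMeasure (volume.restrict (Set.Icc (0 : ℝ) 1)) :=
  ⟨by simp⟩

instance (n : ℕ) : IsProbabilityMeasure (featureLaw n) := by
  unfold featureLaw
  infer_instance

lemma volume_torusBall_le {x ρ : ℝ} (hx : x ∈ Set.Icc (0 : ℝ) 1) (hρ : 0 ≤ ρ) :
    volume.restrict (Set.Icc (0 : ℝ) 1) {z | torusDist x z ≤ ρ} ≤ ENNReal.ofReal (2 * ρ) := by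
  have hmeas : MeasurableSet {z | torusDist x z ≤ ρ} :=
    measurableSet_le (measurable_torusDist.comp measurable_prodMk_left) measurable_const
  have hsub : {z | torusDist x z ≤ ρ} ∩ Set.Icc (0 : ℝ) 1 ⊆
      Set.Icc (max 0 (x - ρ)) (min 1 (x + ρ)) ∪
        (Set.Icc 0 (x + ρ - 1) ∪ Set.Icc (x + 1 - ρ) 1) := by
    rintro z ⟨hz, hz0, hz1⟩
    simp only [Set.mem_ofPred_eq, torusDist, min_le_iff] at hz
    simp only [Set.mem_union, Set.mem_Icc, max_le_iff, le_min_iff]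
    rcases hz with h | h
    · rw [abs_le] at h
      left
      constructor <;> constructor <;> linarith
    · right
      rcases le_total z x with hzx | hzx
      · rw [abs_of_nonneg (by linarith)] at h
        left; constructor <;> linarith
      · rw [abs_of_nonpos (by linarith)] at h
        right; constructor <;> linarith
  rw [Measure.restrict_apply hmeas]
  refine (measure_mono hsub).trans ((measure_union_le _ _).trans
    ((add_le_add_right (measure_union_le _ _) _).trans ?_))
  -- Empty intervals have length `0`; explicit positive parts let the three lengths be added as
  -- reals. What the clipping removes is what wraps around.
  have hmax : ∀ a : ℝ, ENNReal.ofReal a = ENNReal.ofReal (max 0 a) := fun a => by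
    rcases le_total 0 a with h | h <;> simp [h]
  rw [Real.volume_Icc, Real.volume_Icc, Real.volume_Icc,
    hmax (_ - _), hmax (x + ρ - 1 - 0), hmax (1 - (x + 1 - ρ)), ← ENNReal.ofReal_add (le_max_left _ _) (le_max_left _ _), ← ENNReal.ofReal_add (le_max_left _ _)
      (add_nonneg (le_max_left _ _) (le_max_left _ _))]
  refine ENNReal.ofReal_le_ofReal ?_
  obtain ⟨h0, h1⟩ := hx
  grind

/-- An arc sticking out of `[0, 1]` is cut and its outer part translated back. As its length is at
most `1`, the pieces are disjoint once one is taken half-open. -/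
lemma ofReal_le_volume_of_wrap {α β : ℝ} {S : Set ℝ} (h0 : -1 ≤ α) (h1 : α ≤ 1) (h2 : β ≤ 2)
    (h3 : β ≤ α + 1)
    (hS : ∀ z ∈ Set.Icc (0 : ℝ) 1,
      z ∈ Set.Icc α β ∨ z + 1 ∈ Set.Icc α β ∨ z - 1 ∈ Set.Icc α β → z ∈ S) :
    ENNReal.ofReal (β - α) ≤ volume.restrict (Set.Icc (0 : ℝ) 1) S := by
  refine le_trans ?_ (Measure.le_restrict_apply _ _)
  rcases lt_or_ge β α with hβα | hβα
  · rw [ENNReal.ofReal_of_nonpos (by linarith)]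
    exact zero_le
  rcases lt_or_ge α 0 with hα | hα
  · rcases lt_or_ge β 0 with hβ | hβ
    · have hsub : Set.Icc (α + 1) (β + 1) ⊆ S ∩ Set.Icc 0 1 := fun z hz => by
        have hz' : z ∈ Set.Icc (0 : ℝ) 1 := ⟨by linarith [hz.1], by linarith [hz.2]⟩
        exact ⟨hS z hz' (Or.inr (Or.inr ⟨by linarith [hz.1], by linarith [hz.2]⟩)), hz'⟩
      refine le_trans ?_ (measure_mono hsub)
      rw [Real.volume_Icc]
      exact ENNReal.ofReal_le_ofReal (by linarith)
    · have hsub : Set.Icc 0 β ∪ Set.Ioc (α + 1) 1 ⊆ S ∩ Set.Icc 0 1 := by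
        rintro z (hz | hz)
        · have hz' : z ∈ Set.Icc (0 : ℝ) 1 := ⟨hz.1, by linarith [hz.2]⟩
          exact ⟨hS z hz' (Or.inl ⟨by linarith [hz.1], hz.2⟩), hz'⟩
        · have hz' : z ∈ Set.Icc (0 : ℝ) 1 := ⟨by linarith [hz.1], hz.2⟩
          exact ⟨hS z hz' (Or.inr (Or.inr ⟨by linarith [hz.1], by linarith [hz.2]⟩)), hz'⟩
      have hd : Disjoint (Set.Icc 0 β) (Set.Ioc (α + 1) 1) :=
        Set.disjoint_left.2 fun z hz hz' => by linarith [hz.2, hz'.1]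
      refine le_trans ?_ (measure_mono hsub)
      rw [measure_union hd measurableSet_Ioc, Real.volume_Icc, Real.volume_Ioc,
        ← ENNReal.ofReal_add (by linarith) (by linarith)]
      exact ENNReal.ofReal_le_ofReal (by linarith)
  rcases le_or_gt β 1 with hβ | hβ
  · have hsub : Set.Icc α β ⊆ S ∩ Set.Icc 0 1 := fun z hz => by
      have hz' : z ∈ Set.Icc (0 : ℝ) 1 := ⟨by linarith [hz.1], by linarith [hz.2]⟩
      exact ⟨hS z hz' (Or.inl hz), hz'⟩
    refine le_trans ?_ (measure_mono hsub)
    rw [Real.volume_Icc]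
  · have hsub : Set.Icc α 1 ∪ Set.Ico 0 (β - 1) ⊆ S ∩ Set.Icc 0 1 := by
      rintro z (hz | hz)
      · have hz' : z ∈ Set.Icc (0 : ℝ) 1 := ⟨by linarith [hz.1], hz.2⟩
        exact ⟨hS z hz' (Or.inl ⟨hz.1, by linarith [hz.2]⟩), hz'⟩
      · have hz' : z ∈ Set.Icc (0 : ℝ) 1 := ⟨hz.1, by linarith [hz.2]⟩
        exact ⟨hS z hz' (Or.inr (Or.inl ⟨by linarith [hz.1], by linarith [hz.2]⟩)), hz'⟩
    have hd : Disjoint (Set.Icc α 1) (Set.Ico 0 (β - 1)) :=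
      Set.disjoint_left.2 fun z hz hz' => by linarith [hz.1, hz'.2]
    refine le_trans ?_ (measure_mono hsub)
    rw [measure_union hd measurableSet_Ico, Real.volume_Icc, Real.volume_Ico,
      ← ENNReal.ofReal_add (by linarith) (by linarith)]
    exact ENNReal.ofReal_le_ofReal (by linarith)

lemma torusDist_le_abs_of_shift {x z k : ℝ} (hx : x ∈ Set.Icc (0 : ℝ) 1)
    (hz : z ∈ Set.Icc (0 : ℝ) 1) (hk : k = 0 ∨ k = 1 ∨ k = -1) :
    torusDist x z ≤ |x - (z + k)| := by
  obtain ⟨hx0, hx1⟩ := hx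
  obtain ⟨hz0, hz1⟩ := hz
  unfold torusDist
  rw [min_le_iff]
  rcases hk with rfl | rfl | rfl
  · left; simp
  · right
    rw [abs_of_nonpos (by linarith : x - (z + 1) ≤ 0)]
    linarith [le_abs_self (x - z)]
  · right
    rw [abs_of_nonneg (by linarith : 0 ≤ x - (z + -1))]
    linarith [neg_abs_le (x - z)]

/-- Arcs of half-width `A` with centres at most `ρ` apart overlap in length at least `2A - ρ`. When
the short way passes through `0`, the centre `y` is replaced by `y - 1`. -/
lemma le_volume_torusBall_inter {x y ρ A : ℝ} (hx : x ∈ Set.Icc (0 : ℝ) 1)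
    (hy : y ∈ Set.Icc (0 : ℝ) 1) (hA : 0 ≤ A) (hA' : A ≤ 1 / 4) (hxy : torusDist x y ≤ ρ) :
    ENNReal.ofReal (2 * A - ρ) ≤
      volume.restrict (Set.Icc (0 : ℝ) 1) {z | torusDist x z ≤ A ∧ torusDist y z ≤ A} := by
  wlog hle : x ≤ y generalizing x y
  · simpa only [and_comm] using this hy hx (torusDist_comm x y ▸ hxy) (le_of_not_ge hle)
  have hx' := hx
  have hy' := hy
  obtain ⟨hx0, hx1⟩ := hx'
  obtain ⟨hy0, hy1⟩ := hy'
  unfold torusDist at hxy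
  rw [abs_of_nonpos (by linarith), min_le_iff] at hxy
  rcases hxy with h | h
  · refine le_trans (ENNReal.ofReal_le_ofReal (by linarith : 2 * A - ρ ≤ (x + A) - (y - A)))
      (ofReal_le_volume_of_wrap (by linarith) (by linarith) (by linarith) (by linarith) ?_)
    have key : ∀ z ∈ Set.Icc (0 : ℝ) 1, ∀ k : ℝ, (k = 0 ∨ k = 1 ∨ k = -1) →
        z + k ∈ Set.Icc (y - A) (x + A) → torusDist x z ≤ A ∧ torusDist y z ≤ A := by
      intro z hz k hk hzk
      exact ⟨(torusDist_le_abs_of_shift hx hz hk).trans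
          (abs_le.2 ⟨by linarith [hzk.2], by linarith [hzk.1]⟩),
        (torusDist_le_abs_of_shift hy hz hk).trans
          (abs_le.2 ⟨by linarith [hzk.2], by linarith [hzk.1]⟩)⟩
    rintro z hz (h | h | h)
    · exact key z hz 0 (by simp) (by simpa using h)
    · exact key z hz 1 (by simp) h
    · exact key z hz (-1) (by simp) (by simpa [sub_eq_add_neg] using h)
  · refine le_trans (ENNReal.ofReal_le_ofReal (by linarith : 2 * A - ρ ≤ (y - 1 + A) - (x - A)))
      (ofReal_le_volume_of_wrap (by linarith) (by linarith) (by linarith) (by linarith) ?_)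
    have key : ∀ z ∈ Set.Icc (0 : ℝ) 1, ∀ k l : ℝ, (k = 0 ∨ k = 1 ∨ k = -1) →
        (l = 0 ∨ l = 1 ∨ l = -1) → |x - (z + k)| ≤ A → |y - (z + l)| ≤ A →
        torusDist x z ≤ A ∧ torusDist y z ≤ A := by
      intro z hz k l hk hl h1 h2
      exact ⟨(torusDist_le_abs_of_shift hx hz hk).trans h1,
        (torusDist_le_abs_of_shift hy hz hl).trans h2⟩
    rintro z hz (h | h | h)
    · exact key z hz 0 1 (by simp) (by simp)
        (abs_le.2 ⟨by linarith [h.2], by linarith [h.1]⟩)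
        (abs_le.2 ⟨by linarith [h.2], by linarith [h.1]⟩)
    · exfalso
      linarith [h.1, h.2, hz.1]
    · exact key z hz (-1) 0 (by simp) (by simp)
        (abs_le.2 ⟨by linarith [h.2], by linarith [h.1]⟩)
        (abs_le.2 ⟨by linarith [h.2], by linarith [h.1]⟩)

/-! ### Exponential moments of triangle counts. -/

lemma lintegral_ite_le_exp_of_one_le {μ : Measure ℝ} [IsProbabilityMeasure μ] {S : Set ℝ}
    [DecidablePred (· ∈ S)] (hS : MeasurableSet S) {s q : ℝ} (hs : 1 ≤ s) (hq : 0 ≤ q)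
    (h : μ S ≤ ENNReal.ofReal q) :
    ∫⁻ z, (if z ∈ S then ENNReal.ofReal s else 1) ∂μ ≤
      ENNReal.ofReal (Real.exp ((s - 1) * q)) := by
  have hs' : ENNReal.ofReal s = 1 + ENNReal.ofReal (s - 1) := by
    rw [← ENNReal.ofReal_one, ← ENNReal.ofReal_add zero_le_one (by linarith)]
    congr 1; ring
  have heq : ∀ z, (if z ∈ S then ENNReal.ofReal s else 1) =
      1 + S.indicator (fun _ => ENNReal.ofReal (s - 1)) z := by
    intro z
    by_cases hz : z ∈ S <;> simp [hz, hs']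
  simp only [heq]
  rw [lintegral_add_left measurable_const, lintegral_indicator_const hS, lintegral_const,
    measure_univ, mul_one]
  calc 1 + ENNReal.ofReal (s - 1) * μ S
      ≤ 1 + ENNReal.ofReal (s - 1) * ENNReal.ofReal q := by gcongr
    _ = ENNReal.ofReal (1 + (s - 1) * q) := by
      rw [← ENNReal.ofReal_mul (by linarith), ← ENNReal.ofReal_one,
        ← ENNReal.ofReal_add zero_le_one (mul_nonneg (by linarith) hq)]
    _ ≤ _ := ENNReal.ofReal_le_ofReal (by linarith [Real.add_one_le_exp ((s - 1) * q)])

/-- The Bernoulli generating function satisfies `1 - (1 - s) q ≤ exp (-(1 - s) q)`. No sign is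
imposed on `q`: for negative `q` the bound is at least `1`. -/
lemma lintegral_ite_le_exp_of_le_one {μ : Measure ℝ} [IsProbabilityMeasure μ] {S : Set ℝ}
    [DecidablePred (· ∈ S)] (hS : MeasurableSet S) {s q : ℝ} (hs0 : 0 ≤ s) (hs : s ≤ 1) (h : ENNReal.ofReal q ≤ μ S) :
    ∫⁻ z, (if z ∈ S then ENNReal.ofReal s else 1) ∂μ ≤
      ENNReal.ofReal (Real.exp (-((1 - s) * q))) := by
  have heq : ∀ z, (if z ∈ S then ENNReal.ofReal s else 1) +
      S.indicator (fun _ => ENNReal.ofReal (1 - s)) z = 1 := by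
    intro z
    by_cases hz : z ∈ S
    · simp only [hz, if_true, Set.indicator_of_mem]
      rw [← ENNReal.ofReal_add hs0 (by linarith), add_sub_cancel, ENNReal.ofReal_one]
    · simp [hz]
  have hsum : ∫⁻ z, (if z ∈ S then ENNReal.ofReal s else 1) ∂μ +
      ENNReal.ofReal (1 - s) * μ S = 1 := by
    rw [← lintegral_indicator_const hS, ← lintegral_add_right _
      (measurable_const.indicator hS)]
    simp only [heq, lintegral_const, measure_univ, mul_one]
  have hle : ∫⁻ z, (if z ∈ S then ENNReal.ofReal s else 1) ∂μ +
      ENNReal.ofReal ((1 - s) * q) ≤ 1 := by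
    rw [ENNReal.ofReal_mul (by linarith)]
    exact (add_le_add_right (mul_le_mul_right h _) _).trans_eq hsum
  have hfin : ∫⁻ z, (if z ∈ S then ENNReal.ofReal s else 1) ∂μ ≠ ⊤ :=
    ne_top_of_le_ne_top ENNReal.one_ne_top (le_self_add.trans hle)
  rw [ENNReal.le_ofReal_iff_toReal_le hfin (Real.exp_nonneg _)]
  have hle' := ENNReal.toReal_mono ENNReal.one_ne_top hle
  rw [ENNReal.toReal_add hfin ENNReal.ofReal_ne_top, ENNReal.toReal_one] at hle'
  have : (1 - s) * q ≤ (ENNReal.ofReal ((1 - s) * q)).toReal := by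
    rw [ENNReal.toReal_ofReal']
    exact le_max_left _ _
  linarith [Real.add_one_le_exp (-((1 - s) * q))]

open Classical in
/-- The indicator that `x` and `y` are points of `[0, 1]` at distance at most `ρ`. -/
noncomputable def closePair (ρ x y : ℝ) : ENNReal :=
  if x ∈ Set.Icc (0 : ℝ) 1 ∧ y ∈ Set.Icc (0 : ℝ) 1 ∧ torusDist x y ≤ ρ then 1 else 0

lemma measurable_closePair (ρ : ℝ) : Measurable fun p : ℝ × ℝ => closePair ρ p.1 p.2 := by
  unfold closePair
  refine Measurable.ite ?_ measurable_const measurable_const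
  exact (measurable_fst measurableSet_Icc).inter ((measurable_snd measurableSet_Icc).inter
    (measurableSet_le measurable_torusDist measurable_const))

lemma measurable_closePair_apply {n : ℕ} (ρ : ℝ) (u v : Fin n) :
    Measurable fun X : Fin n → ℝ => closePair ρ (X u) (X v) :=
  (measurable_closePair ρ).comp (g := fun p : ℝ × ℝ => closePair ρ p.1 p.2)
    (f := fun X : Fin n → ℝ => (X u, X v))
    ((measurable_pi_apply u).prodMk (measurable_pi_apply v))

open Classical in
/-- `s` to the power of the number of `w` with `(X u, X v, X w) ∈ T w`, on the event that
`X u` and `X v` are within distance `ρ`. -/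
noncomputable def pairPotential {n : ℕ} (T : Fin n → Set (ℝ × ℝ × ℝ)) (ρ s : ℝ) (u v : Fin n)
    (X : Fin n → ℝ) : ENNReal :=
  closePair ρ (X u) (X v) * ∏ w ∈ (Finset.univ.erase u).erase v,
    if (X u, X v, X w) ∈ T w then ENNReal.ofReal s else 1

lemma measurable_pairPotential {n : ℕ} {T : Fin n → Set (ℝ × ℝ × ℝ)}
    (hT : ∀ w, MeasurableSet (T w)) (ρ s : ℝ) (u v : Fin n) :
    Measurable (pairPotential T ρ s u v) := by
  unfold pairPotential
  refine (measurable_closePair_apply ρ u v).mul ?_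
  refine Finset.measurable_prod _ fun w _ => Measurable.ite ?_ measurable_const measurable_const
  exact ((measurable_pi_apply u).prodMk
    ((measurable_pi_apply v).prodMk (measurable_pi_apply w))) (hT w)

lemma lintegral_closePair_le {n : ℕ} {ρ : ℝ} (hρ : 0 ≤ ρ) {u v : Fin n} (huv : u ≠ v) :
    ∫⁻ X, closePair ρ (X u) (X v) ∂featureLaw n ≤ ENNReal.ofReal (2 * ρ) := by
  have h := lintegral_mul_prod_le (μ := fun _ : Fin n => volume.restrict (Set.Icc (0 : ℝ) 1))
    {v} (fun _ => 1) (fun _ X z => closePair ρ (X u) z) (fun _ => ENNReal.ofReal (2 * ρ))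
    measurable_const
    (fun i _ => measurable_closePair_apply ρ u i)
    (fun _ _ _ _ => rfl)
    (fun i hi _ _ X z => by
      rw [Finset.mem_singleton] at hi
      rw [Function.update_of_ne (hi ▸ huv)])
    (fun _ _ X _ => by
      by_cases hx : X u ∈ Set.Icc (0 : ℝ) 1
      · refine le_trans (lintegral_mono fun z => ?_)
          ((lintegral_indicator_one_le {z | torusDist (X u) z ≤ ρ}).trans
            (volume_torusBall_le hx hρ))
        unfold closePair
        by_cases hz : torusDist (X u) z ≤ ρ
        · simp only [Set.indicator, Set.mem_ofPred_eq, hz, if_true, Pi.one_apply]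
          split_ifs <;> simp
        · simp [hz]
      · simp [closePair, hx])
  simpa [featureLaw] using h

-- Given `X u` and `X v`, the moment factors over the other nodes; `2ρ` bounds the probability that
-- the pair is close.
open Classical in
lemma lintegral_pairPotential_le {n : ℕ} {T : Fin n → Set (ℝ × ℝ × ℝ)}
    (hT : ∀ w, MeasurableSet (T w)) {ρ s : ℝ} (hρ : 0 ≤ ρ) {u v : Fin n} (huv : u ≠ v)
    (c : Fin n → ENNReal)
    (hc : ∀ w, ∀ x ∈ Set.Icc (0 : ℝ) 1, ∀ y ∈ Set.Icc (0 : ℝ) 1, torusDist x y ≤ ρ →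
      ∫⁻ z, (if (x, y, z) ∈ T w then ENNReal.ofReal s else 1)
        ∂volume.restrict (Set.Icc (0 : ℝ) 1) ≤ c w) :
    ∫⁻ X, pairPotential T ρ s u v X ∂featureLaw n ≤
      (∏ w ∈ (Finset.univ.erase u).erase v, c w) * ENNReal.ofReal (2 * ρ) := by
  refine le_trans ?_ (mul_le_mul_right (lintegral_closePair_le hρ huv) _)
  have hne : ∀ i ∈ (Finset.univ.erase u).erase v, u ≠ i ∧ v ≠ i := fun i hi => by
    simp only [Finset.mem_erase] at hi
    exact ⟨hi.2.1.symm, hi.1.symm⟩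
  refine lintegral_mul_prod_le (μ := fun _ : Fin n => volume.restrict (Set.Icc (0 : ℝ) 1))
    ((Finset.univ.erase u).erase v) (fun X => closePair ρ (X u) (X v))
    (fun w X z => if (X u, X v, z) ∈ T w then ENNReal.ofReal s else 1) c ?_ ?_ ?_ ?_ ?_
  · exact measurable_closePair_apply ρ u v
  · intro w _
    refine Measurable.ite ?_ measurable_const measurable_const
    exact ((measurable_pi_apply u).prodMk
      ((measurable_pi_apply v).prodMk (measurable_pi_apply w))) (hT w)
  · intro i hi X z
    simp only [Function.update_of_ne (hne i hi).1, Function.update_of_ne (hne i hi).2]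
  · intro i hi j _ X z
    simp only [Function.update_of_ne (hne i hi).1, Function.update_of_ne (hne i hi).2]
  · intro i _ X hX
    simp only [closePair, ne_eq, ite_eq_right_iff, one_ne_zero, imp_false, not_not] at hX
    exact hc i _ hX.1 _ hX.2.1 hX.2.2

open Classical in
lemma pairPotential_eq {n : ℕ} (T : Fin n → Set (ℝ × ℝ × ℝ)) {ρ s : ℝ} {u v : Fin n}
    {X : Fin n → ℝ} (hu : X u ∈ Set.Icc (0 : ℝ) 1) (hv : X v ∈ Set.Icc (0 : ℝ) 1)
    (h : torusDist (X u) (X v) ≤ ρ) :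
    pairPotential T ρ s u v X = ENNReal.ofReal s ^
      (((Finset.univ.erase u).erase v).filter fun w => (X u, X v, X w) ∈ T w).card := by
  rw [pairPotential, closePair, if_pos ⟨hu, hv, h⟩, one_mul, Finset.prod_ite, Finset.prod_const,
    Finset.prod_const_one, mul_one]

/-! ### Cross-cluster and same-cluster pairs. -/

/-- Features `z` of a node `w` that can close a triangle over a cross-cluster pair: `w` is
close to the end of the pair in the other cluster. -/
def crossRegion {n : ℕ} (σ : Fin n → Fin 2) (b : ℝ) (u w : Fin n) : Set (ℝ × ℝ × ℝ) :=
  {p | torusDist (if σ w = σ u then p.2.1 else p.1) p.2.2 ≤ b}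

/-- Features `z` of a node `w` that close a triangle over a pair inside the cluster of `u`. -/
def sameRegion {n : ℕ} (σ : Fin n → Fin 2) (A B : ℝ) (u w : Fin n) : Set (ℝ × ℝ × ℝ) :=
  {p | torusDist p.1 p.2.2 ≤ (if σ w = σ u then A else B) ∧
    torusDist p.2.1 p.2.2 ≤ (if σ w = σ u then A else B)}

lemma measurableSet_crossRegion {n : ℕ} (σ : Fin n → Fin 2) (b : ℝ) (u w : Fin n) :
    MeasurableSet (crossRegion σ b u w) := by
  unfold crossRegion
  refine measurableSet_le (Measurable.torusDist ?_ (by fun_prop)) measurable_const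
  split_ifs <;> fun_prop

lemma measurableSet_sameRegion {n : ℕ} (σ : Fin n → Fin 2) (A B : ℝ) (u w : Fin n) :
    MeasurableSet (sameRegion σ A B u w) := by
  unfold sameRegion
  exact (measurableSet_le (Measurable.torusDist (by fun_prop) (by fun_prop))
    measurable_const).inter
    (measurableSet_le (Measurable.torusDist (by fun_prop) (by fun_prop)) measurable_const)

lemma lintegral_crossPotential_le {n : ℕ} (σ : Fin n → Fin 2) {b s : ℝ} (hb : 0 ≤ b)
    (hs : 1 ≤ s) {u v : Fin n} (huv : u ≠ v) :
    ∫⁻ X, pairPotential (crossRegion σ b u) b s u v X ∂featureLaw n ≤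
      ENNReal.ofReal (Real.exp ((s - 1) * (2 * b * n)) * (2 * b)) := by
  classical
  refine (lintegral_pairPotential_le (measurableSet_crossRegion σ b u) hb huv
    (fun _ => ENNReal.ofReal (Real.exp ((s - 1) * (2 * b)))) ?_).trans ?_
  · intro w x hx y hy _
    refine lintegral_ite_le_exp_of_one_le (S := {z | (x, y, z) ∈ crossRegion σ b u w})
      ((measurable_const.prodMk (measurable_const.prodMk measurable_id))
        (measurableSet_crossRegion σ b u w)) hs (by positivity) ?_
    unfold crossRegion
    simp only [Set.mem_ofPred_eq]
    split_ifs
    · exact volume_torusBall_le hy hb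
    · exact volume_torusBall_le hx hb
  · rw [Finset.prod_const, ENNReal.ofReal_mul (Real.exp_nonneg _)]
    gcongr
    have h1 : (1 : ENNReal) ≤ ENNReal.ofReal (Real.exp ((s - 1) * (2 * b))) := by
      rw [← ENNReal.ofReal_one]
      exact ENNReal.ofReal_le_ofReal
        (Real.one_le_exp (mul_nonneg (by linarith) (by positivity)))
    refine (pow_le_pow_right₀ h1 (Finset.card_le_univ _)).trans_eq ?_
    rw [Fintype.card_fin, ← ENNReal.ofReal_pow (Real.exp_nonneg _), ← Real.exp_nat_mul]
    congr 2
    ring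

lemma card_cluster {n : ℕ} {σ : Fin n → Fin 2} (hσ : IsBalanced σ) (c : Fin 2) :
    2 * ((Finset.univ.filter fun w => σ w = c).card : ℝ) = n := by
  have h : (Finset.univ.filter fun w => σ w = 0).card =
      (Finset.univ.filter fun w => σ w = 1).card := by
    unfold IsBalanced at hσ
    rwa [Set.ncard_eq_toFinset_card', Set.ncard_eq_toFinset_card', Set.toFinset_ofPred,
      Set.toFinset_ofPred] at hσ
  have hsum : (Finset.univ.filter fun w => σ w = 0).card +
      (Finset.univ.filter fun w => σ w = 1).card = n := by
    have := Finset.card_eq_sum_card_fiberwise (s := Finset.univ) (t := Finset.univ) (f := σ)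
      (fun _ _ => Finset.mem_coe.2 (Finset.mem_univ _))
    rw [Fin.sum_univ_two, Finset.card_univ, Fintype.card_fin] at this
    exact this.symm
  have hc : (Finset.univ.filter fun w => σ w = c).card =
      (Finset.univ.filter fun w => σ w = 0).card := by
    fin_cases c
    · rfl
    · exact h.symm
  rw [hc]
  have : 2 * (Finset.univ.filter fun w => σ w = 0).card = n := by omega
  exact_mod_cast this

lemma sum_ite_cluster {n : ℕ} {σ : Fin n → Fin 2} (hσ : IsBalanced σ) (c : Fin 2) (A B : ℝ) :
    ∑ w, (if σ w = c then A else B) = n * (A + B) / 2 := by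
  have h := card_cluster hσ c
  have h2 : ((Finset.univ.filter fun w => σ w = c).card : ℝ) +
      ((Finset.univ.filter fun w => ¬ σ w = c).card : ℝ) = n := by
    exact_mod_cast (Finset.card_filter_add_card_filter_not (s := Finset.univ)
      (fun w => σ w = c)).trans (by simp)
  rw [Finset.sum_ite, Finset.sum_const, Finset.sum_const, nsmul_eq_mul, nsmul_eq_mul]
  linear_combination A / 2 * h + B * h2 - B / 2 * h

/-- By balance the exponents over all `n` nodes sum to `n (A + B - ρ)`, up to the factor `1 - s`.
Omitting `u` and `v` costs at most `2A ≤ 1/2` each, whence the extra `1`. -/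
lemma lintegral_samePotential_le {n : ℕ} {σ : Fin n → Fin 2} (hσ : IsBalanced σ) {A B ρ s : ℝ}
    (hB : 0 ≤ B) (hBA : B ≤ A) (hA : A ≤ 1 / 4) (hρ : 0 ≤ ρ) (hs0 : 0 ≤ s) (hs : s ≤ 1)
    {u v : Fin n} (huv : u ≠ v) (hσuv : σ u = σ v) :
    ∫⁻ X, pairPotential (sameRegion σ A B u) ρ s u v X ∂featureLaw n ≤
      ENNReal.ofReal (Real.exp (1 - (1 - s) * (n * (A + B - ρ))) * (2 * ρ)) := by
  classical
  refine (lintegral_pairPotential_le (measurableSet_sameRegion σ A B u) hρ huv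
    (fun w => ENNReal.ofReal (Real.exp (-((1 - s) * (2 * (if σ w = σ u then A else B) - ρ)))))
    ?_).trans ?_
  · intro w x hx y hy hxy
    refine lintegral_ite_le_exp_of_le_one (S := {z | (x, y, z) ∈ sameRegion σ A B u w})
      ((measurable_const.prodMk (measurable_const.prodMk measurable_id))
        (measurableSet_sameRegion σ A B u w)) hs0 hs ?_
    unfold sameRegion
    simp only [Set.mem_ofPred_eq]
    split_ifs
    · exact le_volume_torusBall_inter hx hy (by linarith) hA hxy
    · exact le_volume_torusBall_inter hx hy hB (by linarith) hxy
  · rw [← ENNReal.ofReal_prod_of_nonneg fun _ _ => Real.exp_nonneg _, ← Real.exp_sum,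
      ENNReal.ofReal_mul (Real.exp_nonneg _)]
    gcongr
    have hv : v ∈ Finset.univ.erase u := by simp [huv.symm]
    have h1 := Finset.add_sum_erase Finset.univ
      (fun w => 2 * (if σ w = σ u then A else B) - ρ) (Finset.mem_univ u)
    have h2 := Finset.add_sum_erase (Finset.univ.erase u)
      (fun w => 2 * (if σ w = σ u then A else B) - ρ) hv
    have h3 : ∑ w, (2 * (if σ w = σ u then A else B) - ρ) = n * (A + B - ρ) := by
      rw [Finset.sum_sub_distrib, ← Finset.mul_sum, sum_ite_cluster hσ]
      simp only [Finset.sum_const, Finset.card_univ, Fintype.card_fin, nsmul_eq_mul]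
      ring
    simp only [hσuv.symm, if_true] at h1 h2
    rw [Finset.sum_neg_distrib, ← Finset.mul_sum]
    have hA0 : 0 ≤ A := hB.trans hBA
    nlinarith

/-! ### Gaps and the right end of the interval. -/

open Classical in
/-- The indicator that `X u ≤ 1 - a` and no node of the cluster of `u` lies in the interval of
length `a` to the right of `X u`. -/
noncomputable def gapPotential {n : ℕ} (σ : Fin n → Fin 2) (a : ℝ) (u : Fin n)
    (X : Fin n → ℝ) : ENNReal :=
  (if X u ∈ Set.Icc 0 (1 - a) then 1 else 0) *
    ∏ w ∈ (Finset.univ.filter fun w => σ w = σ u).erase u,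
      if X w ∈ Set.Ioc (X u) (X u + a) then ENNReal.ofReal 0 else 1

open Classical in
/-- The indicator that `X u` lies in the last interval of length `a`. -/
noncomputable def endPotential {n : ℕ} (a : ℝ) (u : Fin n) (X : Fin n → ℝ) : ENNReal :=
  if X u ∈ Set.Ioc (1 - a) 1 then 1 else 0

lemma measurable_endPotential {n : ℕ} (a : ℝ) (u : Fin n) : Measurable (endPotential a u) :=
  Measurable.ite ((measurable_pi_apply u) measurableSet_Ioc) measurable_const measurable_const

lemma measurableSet_mem_gap {n : ℕ} (a : ℝ) (u w : Fin n) :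
    MeasurableSet {X : Fin n → ℝ | X w ∈ Set.Ioc (X u) (X u + a)} :=
  (measurableSet_lt (measurable_pi_apply u) (measurable_pi_apply w)).inter
    (measurableSet_le (f := fun X : Fin n → ℝ => X w) (g := fun X => X u + a)
      (by fun_prop) (by fun_prop))

lemma measurable_gapPotential {n : ℕ} (σ : Fin n → Fin 2) (a : ℝ) (u : Fin n) :
    Measurable (gapPotential σ a u) := by
  refine Measurable.mul (Measurable.ite ((measurable_pi_apply u) measurableSet_Icc)
    measurable_const measurable_const) ?_
  exact Finset.measurable_prod _ fun w _ =>
    Measurable.ite (measurableSet_mem_gap a u w) measurable_const measurable_const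

lemma lintegral_endPotential_le {n : ℕ} (a : ℝ) (u : Fin n) :
    ∫⁻ X, endPotential a u X ∂featureLaw n ≤ ENNReal.ofReal a := by
  classical
  have h := lintegral_mul_prod_le (μ := fun _ : Fin n => volume.restrict (Set.Icc (0 : ℝ) 1))
    {u} (fun _ => 1) (fun _ _ z => if z ∈ Set.Ioc (1 - a) 1 then 1 else 0)
    (fun _ => ENNReal.ofReal a) measurable_const
    (fun i _ => measurable_endPotential a i)
    (fun _ _ _ _ => rfl) (fun _ _ _ _ _ _ => rfl)
    (fun _ _ _ _ => by
      refine (lintegral_mono fun z => ?_).trans ((lintegral_indicator_one_le (μ := volume.restrict (Set.Icc (0 : ℝ) 1))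
        (Set.Ioc (1 - a) 1)).trans ((Measure.restrict_apply_le _ _).trans ?_))
      · simp only [Set.indicator, Pi.one_apply]
        exact le_of_eq (by congr)
      · rw [Real.volume_Ioc]
        simp)
  simpa [featureLaw, endPotential] using h

/-- A gap is the generating function at `s = 0`: each of the `n/2 - 1` other nodes of the cluster
must avoid an interval of length `a`, which does not leave `[0, 1]`. -/
lemma lintegral_gapPotential_le {n : ℕ} {σ : Fin n → Fin 2} (hσ : IsBalanced σ) {a : ℝ}
    (ha : 0 ≤ a) (u : Fin n) :
    ∫⁻ X, gapPotential σ a u X ∂featureLaw n ≤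
      ENNReal.ofReal (Real.exp (a - a * n / 2)) := by
  classical
  have hne : ∀ i ∈ (Finset.univ.filter fun w => σ w = σ u).erase u, u ≠ i := fun i hi =>
    (Finset.ne_of_mem_erase hi).symm
  refine (lintegral_mul_prod_le (μ := fun _ : Fin n => volume.restrict (Set.Icc (0 : ℝ) 1))
    ((Finset.univ.filter fun w => σ w = σ u).erase u)
    (fun X => if X u ∈ Set.Icc 0 (1 - a) then 1 else 0)
    (fun _ X z => if z ∈ Set.Ioc (X u) (X u + a) then ENNReal.ofReal 0 else 1)
    (fun _ => ENNReal.ofReal (Real.exp (-((1 - 0) * a)))) ?_ ?_ ?_ ?_ ?_).trans ?_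
  · exact Measurable.ite ((measurable_pi_apply u) measurableSet_Icc)
      measurable_const measurable_const
  · exact fun w _ => Measurable.ite (measurableSet_mem_gap a u w) measurable_const measurable_const
  · intro i hi X z
    simp only [Function.update_of_ne (hne i hi)]
  · intro i hi j _ X z
    simp only [Function.update_of_ne (hne i hi)]
  · intro i _ X hX
    simp only [ne_eq, ite_eq_right_iff, one_ne_zero, imp_false, not_not] at hX
    refine lintegral_ite_le_exp_of_le_one (μ := volume.restrict (Set.Icc (0 : ℝ) 1))
      (S := Set.Ioc (X u) (X u + a)) measurableSet_Ioc le_rfl zero_le_one ?_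
    have hsub : Set.Ioc (X u) (X u + a) ⊆ Set.Icc 0 1 :=
      fun z hz => ⟨by linarith [hX.1, hz.1], by linarith [hX.2, hz.2]⟩
    rw [Measure.restrict_apply measurableSet_Ioc, Set.inter_eq_left.2 hsub, Real.volume_Ioc]
    exact ENNReal.ofReal_le_ofReal (by linarith)
  · have h1 : ∫⁻ X : Fin n → ℝ, (if X u ∈ Set.Icc 0 (1 - a) then 1 else 0)
        ∂Measure.pi (fun _ : Fin n => volume.restrict (Set.Icc (0 : ℝ) 1)) ≤ 1 := by
      refine (lintegral_mono (g := fun _ => 1) fun X => ?_).trans_eq (by simp)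
      dsimp only
      split_ifs <;> simp
    refine (mul_le_mul_right h1 _).trans ?_
    rw [mul_one, Finset.prod_const, ← ENNReal.ofReal_pow (Real.exp_nonneg _),
      ← Real.exp_nat_mul]
    refine ENNReal.ofReal_le_ofReal (Real.exp_le_exp.2 ?_)
    have hcard := Finset.card_erase_add_one
      (show u ∈ Finset.univ.filter fun w => σ w = σ u by simp)
    have hc := card_cluster hσ (σ u)
    rw [← hcard] at hc
    push_cast at hc
    nlinarith

/-! ### Deterministic bounds by potentials. -/

/-- The pointwise form of Chernoff's bound: `s ^ (N - k) ≥ 1` for the upper tail with `s ≥ 1` and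
for the lower tail with `s ≤ 1`. -/
lemma one_le_rpow_mul_pow {s k : ℝ} {N : ℕ} (hs : 0 < s) (h : 1 ≤ s ∧ k ≤ N ∨ s ≤ 1 ∧ (N : ℝ) ≤ k) :
    1 ≤ ENNReal.ofReal (s ^ (-k)) * ENNReal.ofReal s ^ N := by
  rw [← ENNReal.ofReal_pow hs.le, ← ENNReal.ofReal_mul (by positivity), ← Real.rpow_natCast,
    ← Real.rpow_add hs, ENNReal.one_le_ofReal]
  rcases h with ⟨h1, h2⟩ | ⟨h1, h2⟩
  · exact Real.one_le_rpow h1 (by linarith)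
  · exact Real.one_le_rpow_of_pos_of_le_one_of_nonpos hs h1 (by linarith)

lemma one_le_crossPotential {n : ℕ} {σ : Fin n → Fin 2} {θ₁ θ₂ s thr : ℝ} {X : Fin n → ℝ}
    (hX : ∀ i, X i ∈ Set.Icc (0 : ℝ) 1) (hs : 1 ≤ s) {u v : Fin n} (hσ : σ u ≠ σ v)
    (h : (phaseOne (gbmGraph σ θ₁ θ₂ X) thr).Adj u v) :
    1 ≤ ENNReal.ofReal (s ^ (-thr)) *
      pairPotential (crossRegion σ (θ₂ * (Real.log n / n)) u) (θ₂ * (Real.log n / n)) s u v X := by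
  classical
  obtain ⟨⟨_, hd⟩, hthr⟩ := h
  rw [if_neg hσ] at hd
  rw [pairPotential_eq _ (hX u) (hX v) hd]
  refine one_le_rpow_mul_pow (by linarith) (Or.inl ⟨hs, hthr.le.trans ?_⟩)
  rw [Nat.cast_le, triangleCount, ← Set.ncard_coe_finset]
  refine Set.ncard_le_ncard ?_
  intro w hw
  rw [SimpleGraph.mem_commonNeighbors] at hw
  obtain ⟨⟨huw, hduw⟩, hvw, hdvw⟩ := hw
  simp only [Finset.coe_filter, Finset.mem_erase, Finset.mem_univ, and_true, Set.mem_ofPred_eq,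
    crossRegion]
  refine ⟨⟨hvw.symm, huw.symm⟩, ?_⟩
  by_cases hw : σ w = σ u
  · rw [if_pos hw]
    rwa [if_neg fun h => hσ (hw.symm.trans h.symm)] at hdvw
  · rw [if_neg hw]
    rwa [if_neg fun h => hw h.symm] at hduw

/-- A pair this close is an edge of the observed graph, so its absence means a low triangle count.
The larger `thr'` allows a fixed `τ` in place of the varying threshold. -/
lemma one_le_samePotential {n : ℕ} {σ : Fin n → Fin 2} {θ₁ θ₂ s thr thr' ρ : ℝ} {X : Fin n → ℝ}
    (hX : ∀ i, X i ∈ Set.Icc (0 : ℝ) 1) (hs0 : 0 < s) (hs : s ≤ 1) (hthr : thr ≤ thr')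
    (hρ : ρ ≤ θ₁ * (Real.log n / n)) {u v : Fin n} (huv : u ≠ v) (hσ : σ u = σ v)
    (hd : torusDist (X u) (X v) ≤ ρ) (h : ¬ (phaseOne (gbmGraph σ θ₁ θ₂ X) thr).Adj u v) :
    1 ≤ ENNReal.ofReal (s ^ (-thr')) *
      pairPotential (sameRegion σ (θ₁ * (Real.log n / n)) (θ₂ * (Real.log n / n)) u)
        ρ s u v X := by
  classical
  have hadj : (gbmGraph σ θ₁ θ₂ X).Adj u v := ⟨huv, by rw [if_pos hσ]; exact hd.trans hρ⟩
  have hle : (triangleCount (gbmGraph σ θ₁ θ₂ X) u v : ℝ) ≤ thr := by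
    by_contra! hlt
    exact h ⟨hadj, hlt⟩
  rw [pairPotential_eq _ (hX u) (hX v) hd]
  refine one_le_rpow_mul_pow hs0 (Or.inr ⟨hs, le_trans ?_ (hle.trans hthr)⟩)
  rw [Nat.cast_le, triangleCount, ← Set.ncard_coe_finset]
  refine Set.ncard_le_ncard ?_
  intro w hw
  rw [Finset.mem_coe, Finset.mem_filter, Finset.mem_erase, Finset.mem_erase] at hw
  obtain ⟨⟨hwv, hwu, _⟩, h1, h2⟩ := hw
  rw [SimpleGraph.mem_commonNeighbors]
  refine ⟨⟨hwu.symm, ?_⟩, hwv.symm, ?_⟩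
  · refine h1.trans_eq ?_
    rw [ite_mul]
    simp only [eq_comm]
  · refine h2.trans_eq ?_
    rw [ite_mul, ← hσ]
    simp only [eq_comm]

lemma labels_eq_of_monochromatic {n : ℕ} {θ₂ t : ℝ} (pick : RepresentativeRule n)
    (σ : Fin n → Fin 2) (G : SimpleGraph (Fin n))
    (h : ∀ u v, (phaseOne G ((2 * θ₂ + t) * Real.log n)).Adj u v → σ u = σ v) :
    (aggressiveRemoval θ₂ t pick σ G).labels = σ := by
  have hreach : ∀ u v, (phaseOne G ((2 * θ₂ + t) * Real.log n)).Reachable u v → σ u = σ v := by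
    rintro u v ⟨p⟩
    induction p with
    | nil => rfl
    | cons hadj _ ih => exact (h _ _ hadj).trans ih
  funext v
  exact hreach _ _ (SimpleGraph.ConnectedComponent.exact
    (pick _ ((phaseOne G ((2 * θ₂ + t) * Real.log n)).connectedComponentMk v)).2)

lemma ncard_queried_le_card {n : ℕ} {θ₂ t : ℝ} (pick : RepresentativeRule n)
    (σ : Fin n → Fin 2) (G : SimpleGraph (Fin n)) :
    (aggressiveRemoval θ₂ t pick σ G).queried.ncard ≤ n :=
  (Set.ncard_le_ncard (Set.subset_univ _)).trans_eq (by simp [Set.ncard_univ])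

/-- The rightmost node of a component has no neighbour further to the right. -/
lemma ncard_queried_le_card_localMax {n : ℕ} {θ₂ t : ℝ} (pick : RepresentativeRule n)
    (σ : Fin n → Fin 2) (G : SimpleGraph (Fin n)) (X : Fin n → ℝ) :
    (aggressiveRemoval θ₂ t pick σ G).queried.ncard ≤
      {u | ∀ w, (phaseOne G ((2 * θ₂ + t) * Real.log n)).Adj u w → X w ≤ X u}.ncard := by
  set H := phaseOne G ((2 * θ₂ + t) * Real.log n) with hH
  have hmax : ∀ C : H.ConnectedComponent, ∃ u ∈ C.supp, ∀ w ∈ C.supp, X w ≤ X u := fun C =>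
    Set.exists_max_image C.supp X (Set.toFinite _) C.nonempty_supp
  choose f hf hfmax using hmax
  have hinj : Function.Injective f := fun C D h => by
    rw [← SimpleGraph.ConnectedComponent.mem_supp_iff C (f C) |>.1 (hf C),
      ← SimpleGraph.ConnectedComponent.mem_supp_iff D (f D) |>.1 (hf D), h]
  have hrange : Set.range f ⊆ {u | ∀ w, H.Adj u w → X w ≤ X u} := by
    rintro _ ⟨C, rfl⟩ w hw
    exact hfmax C w (C.mem_supp_of_adj_mem_supp (hf C) hw)
  calc (aggressiveRemoval θ₂ t pick σ G).queried.ncard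
      ≤ Nat.card H.ConnectedComponent := by
        rw [← Nat.card_coe_set_eq]
        exact Finite.card_range_le _
    _ = (Set.range f).ncard := by
        rw [← Nat.card_coe_set_eq, Nat.card_range_of_injective hinj]
    _ ≤ _ := Set.ncard_le_ncard hrange

/-- If `u` is not near the right end and its cluster has a node `w` just to the right, local
maximality prevents `u` and `w` from being adjacent in `H`. -/
lemma one_le_potential_of_localMax {n : ℕ} {σ : Fin n → Fin 2} {a : ℝ} {X : Fin n → ℝ}
    (hX : ∀ i, X i ∈ Set.Icc (0 : ℝ) 1) {H : SimpleGraph (Fin n)} {Q : Fin n → Fin n → ENNReal}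
    (hQ : ∀ u v, u ≠ v → σ u = σ v → torusDist (X u) (X v) ≤ a → ¬ H.Adj u v → 1 ≤ Q u v)
    {u : Fin n} (hu : ∀ w, H.Adj u w → X w ≤ X u) :
    1 ≤ endPotential a u X + gapPotential σ a u X +
      ∑ v, if u ≠ v ∧ σ u = σ v then Q u v else 0 := by
  classical
  by_cases h1 : 1 - a < X u
  · rw [endPotential, if_pos ⟨h1, (hX u).2⟩, add_assoc]
    exact le_self_add
  by_cases h2 : ∃ w, u ≠ w ∧ σ u = σ w ∧ X w ∈ Set.Ioc (X u) (X u + a)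
  · obtain ⟨w, hw, hσ, hw1, hw2⟩ := h2
    have hd : torusDist (X u) (X w) ≤ a := by
      refine (min_le_left _ _).trans ?_
      rw [abs_of_nonpos (by linarith)]
      linarith
    refine (hQ u w hw hσ hd fun h => absurd (hu w h) (not_le.2 hw1)).trans ?_
    refine le_trans ?_ le_add_self
    refine le_trans ?_ (Finset.single_le_sum (fun _ _ => zero_le) (Finset.mem_univ w))
    rw [if_pos ⟨hw, hσ⟩]
  · have hg : gapPotential σ a u X = 1 := by
      rw [gapPotential, if_pos ⟨(hX u).1, not_lt.1 h1⟩, one_mul]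
      refine Finset.prod_eq_one fun w hw => if_neg fun hmem => h2 ⟨w, ?_, ?_, hmem⟩
      · exact (Finset.ne_of_mem_erase hw).symm
      · simpa [eq_comm] using (Finset.mem_filter.1 (Finset.mem_of_mem_erase hw)).2
    rw [hg, add_right_comm]
    exact le_add_self

lemma ncard_queried_le_potential {n : ℕ} {σ : Fin n → Fin 2} {θ₂ t a : ℝ} {X : Fin n → ℝ}
    (hX : ∀ i, X i ∈ Set.Icc (0 : ℝ) 1) (pick : RepresentativeRule n) (G : SimpleGraph (Fin n))
    {Q : Fin n → Fin n → ENNReal}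
    (hQ : ∀ u v, u ≠ v → σ u = σ v → torusDist (X u) (X v) ≤ a →
      ¬ (phaseOne G ((2 * θ₂ + t) * Real.log n)).Adj u v → 1 ≤ Q u v) :
    ((aggressiveRemoval θ₂ t pick σ G).queried.ncard : ENNReal) ≤
      ∑ u, (endPotential a u X + gapPotential σ a u X +
        ∑ v, if u ≠ v ∧ σ u = σ v then Q u v else 0) := by
  classical
  refine (Nat.cast_le.2 (ncard_queried_le_card_localMax pick σ G X)).trans ?_
  rw [Set.ncard_eq_toFinset_card', ← nsmul_one, ← Finset.sum_const]
  refine (Finset.sum_le_sum fun u hu =>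
    one_le_potential_of_localMax hX hQ (by simpa using hu)).trans ?_
  exact Finset.sum_le_sum_of_subset (Finset.subset_univ _)

lemma ae_mem_Icc_featureLaw (n : ℕ) :
    ∀ᵐ X ∂featureLaw n, ∀ i, X i ∈ Set.Icc (0 : ℝ) 1 := by
  rw [ae_all_iff]
  intro i
  exact (Measure.quasiMeasurePreserving_eval
    (fun _ : Fin n => volume.restrict (Set.Icc (0 : ℝ) 1)) i).ae
    (ae_restrict_mem measurableSet_Icc)

/-! ### Expectations of the total potentials and Markov's inequality. -/

/-- The total number of ways in which a cross-cluster edge can survive, weighted by the Chernoff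
exponential. -/
noncomputable def crossPotential {n : ℕ} (σ : Fin n → Fin 2) (θ₂ s thr : ℝ) (X : Fin n → ℝ) :
    ENNReal :=
  ∑ u, ∑ v, if u ≠ v then ENNReal.ofReal (s ^ (-thr)) *
    pairPotential (crossRegion σ (θ₂ * (Real.log n / n)) u) (θ₂ * (Real.log n / n)) s u v X else 0

/-- An upper bound for the number of components after the removal. -/
noncomputable def componentPotential {n : ℕ} (σ : Fin n → Fin 2) (θ₁ θ₂ ρ s thr : ℝ)
    (X : Fin n → ℝ) : ENNReal :=
  ∑ u, (endPotential (ρ * (Real.log n / n)) u X + gapPotential σ (ρ * (Real.log n / n)) u X +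
    ∑ v, if u ≠ v ∧ σ u = σ v then ENNReal.ofReal (s ^ (-thr)) *
      pairPotential (sameRegion σ (θ₁ * (Real.log n / n)) (θ₂ * (Real.log n / n)) u)
        (ρ * (Real.log n / n)) s u v X else 0)

lemma measurable_crossPotential {n : ℕ} (σ : Fin n → Fin 2) (θ₂ s thr : ℝ) :
    Measurable (crossPotential σ θ₂ s thr) := by
  unfold crossPotential
  refine Finset.measurable_sum _ fun u _ => Finset.measurable_sum _ fun v _ => ?_
  split_ifs
  · exact (measurable_pairPotential (measurableSet_crossRegion σ _ u) _ _ _ _).const_mul _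
  · exact measurable_const

lemma measurable_componentPotential {n : ℕ} (σ : Fin n → Fin 2) (θ₁ θ₂ ρ s thr : ℝ) :
    Measurable (componentPotential σ θ₁ θ₂ ρ s thr) := by
  unfold componentPotential
  refine Finset.measurable_sum _ fun u _ => ((measurable_endPotential _ u).add
    (measurable_gapPotential σ _ u)).add (Finset.measurable_sum _ fun v _ => ?_)
  split_ifs
  · exact (measurable_pairPotential (measurableSet_sameRegion σ _ _ u) _ _ _ _).const_mul _
  · exact measurable_const

lemma ofReal_sum_const {n : ℕ} {x : ℝ} :
    ∑ _u : Fin n, ENNReal.ofReal x = ENNReal.ofReal (n * x) := by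
  rw [Finset.sum_const, Finset.card_univ, Fintype.card_fin, nsmul_eq_mul,
    ENNReal.ofReal_mul (Nat.cast_nonneg n), ENNReal.ofReal_natCast]

lemma lintegral_crossPotential_total_le {n : ℕ} (hn : 2 ≤ n) (σ : Fin n → Fin 2) {θ₂ τ : ℝ}
    (hθ₂ : 0 < θ₂) (hτ : 2 * θ₂ ≤ τ) :
    ∫⁻ X, crossPotential σ θ₂ (τ / (2 * θ₂)) (τ * Real.log n) X ∂featureLaw n ≤
      ENNReal.ofReal (2 * θ₂ * (n * Real.log n *
        Real.exp (-(Real.log n * poissonRate (2 * θ₂) τ)))) := by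
  have hn1 : (1 : ℝ) < n := by exact_mod_cast hn
  have hn0 : (0 : ℝ) < n := by linarith
  have hL : 0 < Real.log n := Real.log_pos hn1
  have hs : 1 ≤ τ / (2 * θ₂) := (one_le_div (by positivity)).2 hτ
  have hs0 : 0 < τ / (2 * θ₂) := by linarith
  set b := θ₂ * (Real.log n / n) with hb
  have hb0 : 0 ≤ b := by positivity
  set s := τ / (2 * θ₂) with hsdef
  have hbound : ∀ u v : Fin n, ∫⁻ X, (if u ≠ v then ENNReal.ofReal (s ^ (-(τ * Real.log n))) *
      pairPotential (crossRegion σ b u) b s u v X else 0) ∂featureLaw n ≤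
      ENNReal.ofReal (s ^ (-(τ * Real.log n)) *
        (Real.exp ((s - 1) * (2 * b * n)) * (2 * b))) := by
    intro u v
    split_ifs with huv
    · rw [lintegral_const_mul _
        (measurable_pairPotential (measurableSet_crossRegion σ _ u) _ _ _ _),
        ENNReal.ofReal_mul (by positivity)]
      gcongr
      exact lintegral_crossPotential_le σ hb0 hs huv
    · simp
  have hm : ∀ u v : Fin n, Measurable fun X => (if u ≠ v then
      ENNReal.ofReal (s ^ (-(τ * Real.log n))) *
      pairPotential (crossRegion σ b u) b s u v X else 0) := by
    intro u v
    split_ifs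
    · exact (measurable_pairPotential (measurableSet_crossRegion σ _ u) _ _ _ _).const_mul _
    · exact measurable_const
  unfold crossPotential
  rw [lintegral_finsetSum _ fun u _ => Finset.measurable_sum _ fun v _ => hm u v]
  refine (Finset.sum_le_sum fun u _ => (lintegral_finsetSum _ fun v _ => hm u v).le.trans
    (Finset.sum_le_sum fun v _ => hbound u v)).trans ?_
  rw [Finset.sum_congr rfl fun u _ => ofReal_sum_const, ofReal_sum_const]
  refine ENNReal.ofReal_le_ofReal (le_of_eq ?_)
  -- The choice `s = τ / (2 θ₂)` minimises the Chernoff exponent and yields the Poisson rate.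
  have hrate : s ^ (-(τ * Real.log n)) * Real.exp ((s - 1) * (2 * b * n)) =
      Real.exp (-(Real.log n * poissonRate (2 * θ₂) τ)) := by
    rw [Real.rpow_def_of_pos hs0, ← Real.exp_add]
    congr 1
    unfold poissonRate
    rw [← hsdef, hb]
    have : s * (2 * θ₂) = τ := div_mul_cancel₀ _ (by positivity)
    field_simp
    linear_combination this
  rw [← hrate, hb]
  field_simp

lemma lintegral_componentPotential_le {n : ℕ} (hn : 2 ≤ n) {σ : Fin n → Fin 2}
    (hσ : IsBalanced σ) {θ₁ θ₂ ρ τ : ℝ} (hθ₂ : 0 < θ₂) (hθ : θ₂ ≤ θ₁)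
    (hsmall : θ₁ * (Real.log n / n) ≤ 1 / 4) (hρ : 0 ≤ ρ) (hτ0 : 0 < τ)
    (hτ : τ < θ₁ + θ₂ - ρ) :
    ∫⁻ X, componentPotential σ θ₁ θ₂ ρ (τ / (θ₁ + θ₂ - ρ)) (τ * Real.log n) X ∂featureLaw n ≤
      ENNReal.ofReal (ρ * Real.log n + Real.exp ρ * (n * Real.exp (-(Real.log n * (ρ / 2)))) +
        2 * Real.exp 1 * ρ * (n * Real.log n *
          Real.exp (-(Real.log n * poissonRate (θ₁ + θ₂ - ρ) τ)))) := by
  have hn1 : (1 : ℝ) < n := by exact_mod_cast hn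
  have hn0 : (0 : ℝ) < n := by linarith
  have hL : 0 < Real.log n := Real.log_pos hn1
  have hm0 : 0 < θ₁ + θ₂ - ρ := hτ0.trans hτ
  set m := θ₁ + θ₂ - ρ with hmdef
  have hs : τ / m ≤ 1 := (div_le_one hm0).2 hτ.le
  have hs0 : 0 < τ / m := div_pos hτ0 hm0
  set s := τ / m with hsdef
  set h := Real.log n / n with hh
  have hh0 : 0 < h := by positivity
  have hhn : h * n = Real.log n := div_mul_cancel₀ _ hn0.ne'
  set k := s ^ (-(τ * Real.log n)) with hk
  have hk0 : 0 ≤ k := by positivity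
  have hbound : ∀ u v : Fin n, ∫⁻ X, (if u ≠ v ∧ σ u = σ v then ENNReal.ofReal k *
      pairPotential (sameRegion σ (θ₁ * h) (θ₂ * h) u) (ρ * h) s u v X else 0) ∂featureLaw n ≤
      ENNReal.ofReal (k * (Real.exp (1 - (1 - s) * (n * (θ₁ * h + θ₂ * h - ρ * h))) *
        (2 * (ρ * h)))) := by
    intro u v
    split_ifs with huv
    · rw [lintegral_const_mul _
        (measurable_pairPotential (measurableSet_sameRegion σ _ _ u) _ _ _ _),
        ENNReal.ofReal_mul hk0]
      gcongr
      exact lintegral_samePotential_le hσ (by positivity) (by gcongr) hsmall (by positivity)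
        hs0.le hs huv.1 huv.2
    · simp
  have hm : ∀ u v : Fin n, Measurable fun X => (if u ≠ v ∧ σ u = σ v then ENNReal.ofReal k *
      pairPotential (sameRegion σ (θ₁ * h) (θ₂ * h) u) (ρ * h) s u v X else 0) := by
    intro u v
    split_ifs
    · exact (measurable_pairPotential (measurableSet_sameRegion σ _ _ u) _ _ _ _).const_mul _
    · exact measurable_const
  have hnode : ∀ u : Fin n, ∫⁻ X, (endPotential (ρ * h) u X + gapPotential σ (ρ * h) u X +
      ∑ v, if u ≠ v ∧ σ u = σ v then ENNReal.ofReal k *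
        pairPotential (sameRegion σ (θ₁ * h) (θ₂ * h) u) (ρ * h) s u v X else 0) ∂featureLaw n ≤
      ENNReal.ofReal (ρ * h + Real.exp (ρ * h - ρ * h * n / 2) +
        n * (k * (Real.exp (1 - (1 - s) * (n * (θ₁ * h + θ₂ * h - ρ * h))) *
        (2 * (ρ * h))))) := by
    intro u
    rw [lintegral_add_right _ (Finset.measurable_sum _ fun v _ => hm u v),
      lintegral_add_right _ (measurable_gapPotential σ _ u),
      lintegral_finsetSum _ fun v _ => hm u v,
      ENNReal.ofReal_add (by positivity) (by positivity),
      ENNReal.ofReal_add (by positivity) (by positivity), ← ofReal_sum_const]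
    gcongr with v _
    · exact lintegral_endPotential_le _ u
    · exact lintegral_gapPotential_le hσ (by positivity) u
    · exact hbound u v
  unfold componentPotential
  refine (lintegral_finsetSum _ fun u _ => ((measurable_endPotential _ u).add
    (measurable_gapPotential σ _ u)).add
      (Finset.measurable_sum _ fun v _ => hm u v)).le.trans ?_
  refine (Finset.sum_le_sum fun u _ => hnode u).trans ?_
  rw [ofReal_sum_const]
  refine ENNReal.ofReal_le_ofReal ?_
  have hrate : k * Real.exp (1 - (1 - s) * (n * (θ₁ * h + θ₂ * h - ρ * h))) =
      Real.exp 1 * Real.exp (-(Real.log n * poissonRate m τ)) := by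
    rw [hk, Real.rpow_def_of_pos hs0, ← Real.exp_add, ← Real.exp_add]
    congr 1
    unfold poissonRate
    rw [← hsdef, ← hhn]
    have : s * m = τ := div_mul_cancel₀ _ hm0.ne'
    rw [hmdef] at this ⊢
    linear_combination h * n * this
  -- The node missing from its own gap count costs a factor `exp (ρ h)`, at most `exp ρ` since `log
  -- n ≤ n`.
  have hexp : Real.exp (ρ * h - ρ * h * n / 2) ≤
      Real.exp ρ * Real.exp (-(Real.log n * (ρ / 2))) := by
    rw [← Real.exp_add]
    refine Real.exp_le_exp.2 ?_
    have hle : h ≤ 1 := by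
      rw [hh, div_le_one hn0]
      linarith [Real.log_le_sub_one_of_pos hn0]
    rw [← hhn]
    nlinarith [mul_le_mul_of_nonneg_left hle hρ]
  calc (n : ℝ) * (ρ * h + Real.exp (ρ * h - ρ * h * n / 2) +
        n * (k * (Real.exp (1 - (1 - s) * (n * (θ₁ * h + θ₂ * h - ρ * h))) * (2 * (ρ * h)))))
      = ρ * (h * n) + n * Real.exp (ρ * h - ρ * h * n / 2) + n * (2 * ρ * (h * n)) *
          (k * Real.exp (1 - (1 - s) * (n * (θ₁ * h + θ₂ * h - ρ * h)))) := by ring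
    _ ≤ ρ * (h * n) + n * (Real.exp ρ * Real.exp (-(Real.log n * (ρ / 2)))) +
          n * (2 * ρ * (h * n)) * (Real.exp 1 * Real.exp (-(Real.log n * poissonRate m τ))) := by
        rw [hrate]
        gcongr
    _ = _ := by rw [hhn]; ring

lemma featureLaw_crossPotential_le {n : ℕ} (hn : 2 ≤ n) (σ : Fin n → Fin 2) {θ₂ : ℝ}
    (hθ₂ : 0 < θ₂) :
    featureLaw n {X | 1 ≤ crossPotential σ θ₂ ((2 * θ₂ + tOneAt θ₂ n) / (2 * θ₂))
      ((2 * θ₂ + tOneAt θ₂ n) * Real.log n) X} ≤ ENNReal.ofReal (2 * θ₂ / Real.log n) := by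
  have hn1 : (1 : ℝ) < n := by exact_mod_cast hn
  have hL : 0 < Real.log n := Real.log_pos hn1
  have ht : 0 ≤ tOneAt θ₂ n := tailParam_nonneg _ _
  have hmarkov := mul_meas_ge_le_lintegral (μ := featureLaw n)
    (measurable_crossPotential σ θ₂ ((2 * θ₂ + tOneAt θ₂ n) / (2 * θ₂))
      ((2 * θ₂ + tOneAt θ₂ n) * Real.log n)) 1
  rw [one_mul] at hmarkov
  refine hmarkov.trans ((lintegral_crossPotential_total_le hn σ hθ₂ (by linarith)).trans ?_)
  refine ENNReal.ofReal_le_ofReal ?_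
  rw [div_eq_mul_inv]
  refine mul_le_mul_of_nonneg_left ?_ (by positivity)
  have hrate := le_poissonRate_tailParam hθ₂ (1 + 2 * Real.log (Real.log n) / Real.log n)
  change _ ≤ poissonRate (2 * θ₂) (2 * θ₂ + tOneAt θ₂ n) at hrate
  -- The correction `2 log log n / log n` contributes the factor `(log n)⁻²`; one power cancels the
  -- `log n` from the probability that the pair is close, the other makes the bound vanish.
  have hexp : Real.exp (-(Real.log n * poissonRate (2 * θ₂) (2 * θ₂ + tOneAt θ₂ n))) ≤
      (n * Real.log n ^ 2)⁻¹ := by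
    have h1 := mul_le_mul_of_nonneg_left hrate hL.le
    have h2 : Real.log n * (1 + 2 * Real.log (Real.log n) / Real.log n) =
        Real.log (n * Real.log n ^ 2) := by
      rw [Real.log_mul (by linarith) (by positivity), Real.log_pow]
      field_simp
      push_cast
      ring
    rw [h2] at h1
    rw [Real.exp_neg]
    refine inv_anti₀ (by positivity) ?_
    rw [← Real.log_le_iff_le_exp (by positivity)]
    exact h1
  calc (n : ℝ) * Real.log n * Real.exp (-(Real.log n *
        poissonRate (2 * θ₂) (2 * θ₂ + tOneAt θ₂ n)))
      ≤ n * Real.log n * (n * Real.log n ^ 2)⁻¹ := by gcongr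
    _ = (Real.log n)⁻¹ := by
      have : (n : ℝ) ≠ 0 := by linarith
      field_simp

lemma featureLaw_componentPotential_le {n : ℕ} (hn : 2 ≤ n) {σ : Fin n → Fin 2}
    (hσ : IsBalanced σ) {θ₁ θ₂ ρ τ r : ℝ} (hθ₂ : 0 < θ₂) (hθ : θ₂ ≤ θ₁)
    (hsmall : θ₁ * (Real.log n / n) ≤ 1 / 4) (hρ : 0 ≤ ρ) (hτ0 : 0 < τ)
    (hτ : τ < θ₁ + θ₂ - ρ) :
    featureLaw n {X | ENNReal.ofReal ((n : ℝ) ^ (1 - r / 2)) ≤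
      componentPotential σ θ₁ θ₂ ρ (τ / (θ₁ + θ₂ - ρ)) (τ * Real.log n) X} ≤
    ENNReal.ofReal (ρ * (Real.log n * Real.exp (-(1 - r / 2) * Real.log n)) +
      Real.exp ρ * Real.exp (-((ρ - r) / 2) * Real.log n) +
      2 * Real.exp 1 * ρ * (Real.log n *
        Real.exp (-(poissonRate (θ₁ + θ₂ - ρ) τ - r / 2) * Real.log n))) := by
  have hn0 : (0 : ℝ) < n := by positivity
  have hM : 0 < (n : ℝ) ^ (1 - r / 2) := by positivity
  refine (meas_ge_le_lintegral_div (measurable_componentPotential ..).aemeasurable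
    (by simpa using hM) ENNReal.ofReal_ne_top).trans ?_
  refine (ENNReal.div_le_div_right
    (lintegral_componentPotential_le hn hσ hθ₂ hθ hsmall hρ hτ0 hτ) _).trans ?_
  rw [← ENNReal.ofReal_div_of_pos hM]
  refine ENNReal.ofReal_le_ofReal (le_of_eq ?_)
  set L := Real.log n with hL
  have hnL : (n : ℝ) = Real.exp L := (Real.exp_log hn0).symm
  have hMexp : (n : ℝ) ^ (1 - r / 2) = Real.exp (L * (1 - r / 2)) := Real.rpow_def_of_pos hn0 _
  rw [hMexp, div_eq_mul_inv, ← Real.exp_neg, hnL]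
  have e1 : Real.exp (-(1 - r / 2) * L) = Real.exp (-(L * (1 - r / 2))) := by
    congr 1; ring
  have e2 : Real.exp (-((ρ - r) / 2) * L) =
      Real.exp L * Real.exp (-(L * (ρ / 2))) * Real.exp (-(L * (1 - r / 2))) := by
    rw [← Real.exp_add, ← Real.exp_add]; congr 1; ring
  have e3 : Real.exp (-(poissonRate (θ₁ + θ₂ - ρ) τ - r / 2) * L) =
      Real.exp L * Real.exp (-(L * poissonRate (θ₁ + θ₂ - ρ) τ)) *
        Real.exp (-(L * (1 - r / 2))) := by
    rw [← Real.exp_add, ← Real.exp_add]; congr 1; ring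
  rw [e1, e2, e3]
  ring

/-! ### Limits and conclusion. -/

lemma tendsto_mul_exp_neg_mul_log {b : ℝ} (hb : 0 < b) :
    Tendsto (fun n : ℕ => Real.log n * Real.exp (-b * Real.log n)) atTop (𝓝 0) := by
  have h := (tendsto_rpow_mul_exp_neg_mul_atTop_nhds_zero 1 b hb).comp
    (Real.tendsto_log_atTop.comp tendsto_natCast_atTop_atTop)
  simpa [Function.comp_def] using h

lemma tendsto_exp_neg_mul_log {b : ℝ} (hb : 0 < b) :
    Tendsto (fun n : ℕ => Real.exp (-b * Real.log n)) atTop (𝓝 0) := by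
  have h := (tendsto_rpow_mul_exp_neg_mul_atTop_nhds_zero 0 b hb).comp
    (Real.tendsto_log_atTop.comp tendsto_natCast_atTop_atTop)
  simpa [Function.comp_def] using h

lemma tendsto_log_div_self : Tendsto (fun n : ℕ => Real.log n / n) atTop (𝓝 0) := by
  have h : Tendsto (fun x : ℝ => Real.log x / x) atTop (𝓝 0) := by
    simpa using Real.isLittleO_log_id_atTop.tendsto_div_nhds_zero
  exact h.comp tendsto_natCast_atTop_atTop

/-- With probability tending to one, uniformly in the labelling, the number of queries is at most
`n ^ (1 - R / 2)` up to the constants of the statement. -/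
lemma exists_query_bound {θ₁ θ₂ : ℝ} (hθ : 2 * θ₂ ≤ θ₁) (hθ₂ : 1 ≤ θ₂)
    (hη : θ₁ + θ₂ - 2 - etaParam θ₁ θ₂ < 2 * θ₂ + tOne θ₂) :
    ∃ e : ℕ → ℝ, Tendsto e atTop (𝓝 0) ∧ (∀ n, 0 ≤ e n) ∧
      ∀ᶠ n : ℕ in atTop, ∀ σ : Fin n → Fin 2, IsBalanced σ →
        ∃ B : Set (Fin n → ℝ), featureLaw n B ≤ ENNReal.ofReal (e n) ∧
          ∀ X ∉ B, (∀ i, X i ∈ Set.Icc (0 : ℝ) 1) → ∀ pick : RepresentativeRule n,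
            ((aggressiveRemoval θ₂ (tOneAt θ₂ n) pick σ
              (gbmGraph σ θ₁ θ₂ X)).queried.ncard : ℝ)
                ≤ 3 / 2 * (n : ℝ) ^ (1 - survivalRadius θ₁ θ₂ / 2) + 2 := by
  rcases survivalRadius_cases hθ₂ hη with hR | ⟨hR0, hR2, ρ, τ, hRρ, hρ2, hτ₀, hτ, hrate⟩
  · refine ⟨fun _ => 0, tendsto_const_nhds, fun _ => le_rfl,
      Eventually.of_forall fun n σ _ => ⟨∅, by simp, fun X _ _ pick => ?_⟩⟩
    have h : ((aggressiveRemoval θ₂ (tOneAt θ₂ n) pick σ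
        (gbmGraph σ θ₁ θ₂ X)).queried.ncard : ℝ) ≤ n := by
      exact_mod_cast ncard_queried_le_card pick σ _
    rw [hR, zero_div, sub_zero, Real.rpow_one]
    linarith [(Nat.cast_nonneg n : (0 : ℝ) ≤ n)]
  set R := survivalRadius θ₁ θ₂ with hR
  have hρ0 : 0 < ρ := hR0.trans hRρ
  have ht₁ : 0 ≤ tOne θ₂ := tailParam_nonneg _ _
  have hτ0 : 0 < τ := by linarith
  have hm0 : 0 < θ₁ + θ₂ - ρ := by linarith
  refine ⟨fun n => |ρ * (Real.log n * Real.exp (-(1 - R / 2) * Real.log n)) +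
      Real.exp ρ * Real.exp (-((ρ - R) / 2) * Real.log n) +
      2 * Real.exp 1 * ρ * (Real.log n *
        Real.exp (-(poissonRate (θ₁ + θ₂ - ρ) τ - R / 2) * Real.log n))|, ?_,
    fun _ => abs_nonneg _, ?_⟩
  · have h1 := (tendsto_mul_exp_neg_mul_log (b := 1 - R / 2) (by linarith)).const_mul ρ
    have h2 := (tendsto_exp_neg_mul_log (b := (ρ - R) / 2) (by linarith)).const_mul (Real.exp ρ)
    have h3 := (tendsto_mul_exp_neg_mul_log (b := poissonRate (θ₁ + θ₂ - ρ) τ - R / 2)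
      (by linarith)).const_mul (2 * Real.exp 1 * ρ)
    simpa using ((h1.add h2).add h3).abs
  have hev1 : ∀ᶠ n : ℕ in atTop, tOneAt θ₂ n < τ - 2 * θ₂ :=
    (tendsto_tOneAt (by linarith : 0 < θ₂)).eventually_lt_const (by linarith)
  have hev2 : ∀ᶠ n : ℕ in atTop, θ₁ * (Real.log n / n) < 1 / 4 := by
    have h := tendsto_log_div_self.const_mul θ₁
    rw [mul_zero] at h
    exact h.eventually_lt_const (by norm_num)
  filter_upwards [hev1, hev2, eventually_ge_atTop 2] with n hn1 hn2 hn σ hσ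
  have hL : 0 < Real.log n := Real.log_pos (by exact_mod_cast hn)
  refine ⟨_, (featureLaw_componentPotential_le hn hσ (r := R) (by linarith) (by linarith) hn2.le
    hρ0.le hτ0 hτ).trans (ENNReal.ofReal_le_ofReal (le_abs_self _)), fun X hXB hX pick => ?_⟩
  simp only [Set.mem_ofPred_eq, not_le] at hXB
  have hq := (ncard_queried_le_potential (θ₂ := θ₂) (t := tOneAt θ₂ n) hX pick
    (gbmGraph σ θ₁ θ₂ X) (σ := σ)
    (Q := fun u v => ENNReal.ofReal ((τ / (θ₁ + θ₂ - ρ)) ^ (-(τ * Real.log n))) *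
      pairPotential (sameRegion σ (θ₁ * (Real.log n / n)) (θ₂ * (Real.log n / n)) u)
        (ρ * (Real.log n / n)) (τ / (θ₁ + θ₂ - ρ)) u v X)
    (fun u v huv hσuv hd hadj => one_le_samePotential hX (div_pos hτ0 hm0)
      ((div_le_one hm0).2 hτ.le) (mul_le_mul_of_nonneg_right (by linarith) hL.le)
      (mul_le_mul_of_nonneg_right (by linarith) (by positivity)) huv hσuv hd hadj)).trans_lt hXB
  rw [← ENNReal.ofReal_natCast, ENNReal.ofReal_lt_ofReal_iff (by positivity)] at hq
  have : 0 ≤ (n : ℝ) ^ (1 - R / 2) := by positivity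
  linarith

/-- Outside an event of small probability no cross-cluster edge survives, hence the labels are
correct. -/
lemma labels_eq_of_crossPotential_lt_one {n : ℕ} {σ : Fin n → Fin 2} {θ₁ θ₂ t : ℝ}
    (hθ₂ : 0 < θ₂) (ht : 0 ≤ t) {X : Fin n → ℝ} (hX : ∀ i, X i ∈ Set.Icc (0 : ℝ) 1)
    (h : crossPotential σ θ₂ ((2 * θ₂ + t) / (2 * θ₂)) ((2 * θ₂ + t) * Real.log n) X < 1)
    (pick : RepresentativeRule n) :
    (aggressiveRemoval θ₂ t pick σ (gbmGraph σ θ₁ θ₂ X)).labels = σ := by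
  refine labels_eq_of_monochromatic pick σ _ fun u v huv => ?_
  by_contra hσ
  refine absurd h (not_lt.2 ?_)
  have hs : 1 ≤ (2 * θ₂ + t) / (2 * θ₂) := (one_le_div (by positivity)).2 (by linarith)
  refine (one_le_crossPotential hX hs hσ huv).trans ?_
  unfold crossPotential
  refine le_trans ?_ (Finset.single_le_sum (fun _ _ => zero_le) (Finset.mem_univ u))
  refine le_trans ?_ (Finset.single_le_sum (fun _ _ => zero_le) (Finset.mem_univ v))
  rw [if_pos huv.ne]

theorem theorem4 (θ₁ θ₂ : ℝ) (hθ : 2 * θ₂ ≤ θ₁) (hθ₂ : 1 ≤ θ₂)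
    (hη : θ₁ + θ₂ - 2 - etaParam θ₁ θ₂ < 2 * θ₂ + tOne θ₂) :
    Tendsto (tOneAt θ₂) atTop (𝓝 (tOne θ₂)) ∧
    ∃ δ : ℕ → ℝ, Tendsto δ atTop (𝓝 0) ∧
      ∀ (n : ℕ) (σ : Fin n → Fin 2), IsBalanced σ →
        1 - δ n ≤ (featureLaw n).real
          {X : Fin n → ℝ | ∀ pick : RepresentativeRule n,
            (aggressiveRemoval θ₂ (tOneAt θ₂ n) pick σ (gbmGraph σ θ₁ θ₂ X)).labels = σ ∧
            ((aggressiveRemoval θ₂ (tOneAt θ₂ n) pick σ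
                (gbmGraph σ θ₁ θ₂ X)).queried.ncard : ℝ)
              ≤ 3 / 2 * (n : ℝ) ^ (1 - survivalRadius θ₁ θ₂ / 2) + 2} := by
  classical
  have hθ₂0 : 0 < θ₂ := by linarith
  refine ⟨tendsto_tOneAt hθ₂0, ?_⟩
  obtain ⟨e, he, he0, hev⟩ := exists_query_bound hθ hθ₂ hη
  obtain ⟨N, hN⟩ := eventually_atTop.1 (hev.and (eventually_ge_atTop 2))
  -- For small `n` the value `1` makes the claim trivial.
  refine ⟨fun n => if N ≤ n then 2 * θ₂ / Real.log n + e n else 1, ?_, fun n σ hσ => ?_⟩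
  · have h : Tendsto (fun n : ℕ => 2 * θ₂ / Real.log n + e n) atTop (𝓝 0) := by
      simpa using (tendsto_const_nhds.div_atTop
        (Real.tendsto_log_atTop.comp tendsto_natCast_atTop_atTop)).add he
    refine h.congr' ?_
    filter_upwards [eventually_ge_atTop N] with n hn
    rw [if_pos hn]
  dsimp only
  split_ifs with hn
  swap
  · rw [sub_self]
    exact measureReal_nonneg
  obtain ⟨hb, hn2⟩ := hN n hn
  obtain ⟨B, hB, hgood⟩ := hb σ hσ
  have hL : 0 < Real.log n := Real.log_pos (by exact_mod_cast hn2)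
  set S := {X : Fin n → ℝ | ∀ pick : RepresentativeRule n,
    (aggressiveRemoval θ₂ (tOneAt θ₂ n) pick σ (gbmGraph σ θ₁ θ₂ X)).labels = σ ∧
    ((aggressiveRemoval θ₂ (tOneAt θ₂ n) pick σ (gbmGraph σ θ₁ θ₂ X)).queried.ncard : ℝ)
      ≤ 3 / 2 * (n : ℝ) ^ (1 - survivalRadius θ₁ θ₂ / 2) + 2} with hS
  set C := {X | 1 ≤ crossPotential σ θ₂ ((2 * θ₂ + tOneAt θ₂ n) / (2 * θ₂))
      ((2 * θ₂ + tOneAt θ₂ n) * Real.log n) X} with hC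
  set D := {X : Fin n → ℝ | ∀ i, X i ∈ Set.Icc (0 : ℝ) 1}ᶜ with hD
  have hD0 : featureLaw n D = 0 := ae_iff.1 (ae_mem_Icc_featureLaw n)
  -- Covering the whole space by the success event and the bad events needs only subadditivity, not
  -- measurability of the success event. The bad events do not involve `pick`, so the bound is
  -- uniform in the choice of representatives.
  have hcover : Set.univ ⊆ S ∪ (D ∪ (C ∪ B)) := by
    intro X _
    by_cases hX : ∀ i, X i ∈ Set.Icc (0 : ℝ) 1
    swap
    · exact Or.inr (Or.inl hX)
    by_cases hXC : X ∈ C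
    · exact Or.inr (Or.inr (Or.inl hXC))
    by_cases hXB : X ∈ B
    · exact Or.inr (Or.inr (Or.inr hXB))
    · exact Or.inl fun pick => ⟨labels_eq_of_crossPotential_lt_one hθ₂0 (tailParam_nonneg _ _) hX
        (not_le.1 hXC) pick, hgood X hXB hX pick⟩
  have h1 : (1 : ENNReal) ≤ featureLaw n S +
      ENNReal.ofReal (2 * θ₂ / Real.log n + e n) := by
    calc (1 : ENNReal) = featureLaw n Set.univ := measure_univ.symm
      _ ≤ featureLaw n S + (featureLaw n D + (featureLaw n C + featureLaw n B)) :=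
        (measure_mono hcover).trans ((measure_union_le _ _).trans (add_le_add_right
          ((measure_union_le _ _).trans (add_le_add_right (measure_union_le _ _) _)) _))
      _ ≤ featureLaw n S + ENNReal.ofReal (2 * θ₂ / Real.log n + e n) := by
        rw [hD0, zero_add, ENNReal.ofReal_add (by positivity) (he0 n)]
        gcongr
        exact featureLaw_crossPotential_le hn2 σ hθ₂0
  have h2 := ENNReal.toReal_mono (by finiteness) h1
  rw [ENNReal.toReal_add (by finiteness) ENNReal.ofReal_ne_top, ENNReal.toReal_one,
    ENNReal.toReal_ofReal (add_nonneg (by positivity) (he0 n))] at h2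
  rw [measureReal_def]
  linarith
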